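/- **Setting.** Let $X=\{x\in\{0,1\}^m: Hx\le h\}$, $Y(x)=\{y\in\mathbb R^n_{+}: Fy+Lx\le f\}$, $S=\{c\in\mathbb R^n: Bc\le b\}$, $\alpha_l,\alpha_f\in(0,1)$, and let $\mathbb Q^*$ be a probability distribution on $S$. Put $a^+=\max\{a,0\}$, $a^-=\min\{a,0\}$ and, for a distribution $\mathbb Q$ on $S$, $$\rho_l(y,\mathbb Q)=\min_{t\in\mathbb R}\Big\{t+\tfrac1{1-\alpha_l}\mathbb E_{\mathbb Q}(c^\top y-t)^+\Big\},\qquad \rho_f(y,\mathbb Q)=\max_{t\in\mathbb R}\Big\{t+\tfrac1{1-\alpha_f}\mathbb E_{\mathbb Q}(c^\top y-t)^-\Big\}.$$ Let $\hat c^{(1)},\hat c^{(2)},\dots$ be i.i.d. with law $\mathbb Q^*$, with joint law $\mathbb Q^{*\infty}$. The leader observes the first $k_l$ and the follower the first $k_f$ samples, $1\le k_f\le k_l$. For $i\in\{l,f\}$ let $\mathcal Q_i$ be the set of distributions $\mathbb Q$ on $S$ with $W^p(\hat{\mathbb Q}_i,\mathbb Q)\le\varepsilon_i(k_i)$, where $\hat{\mathbb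 Q}_i$ is the empirical distribution of the $k_i$ samples and $W^p$ is the type-1 Wasserstein distance with respect to the $\ell_p$-norm, $1\le p\le\infty$. Let $\underline t$ and $\overline t$ be the minimum and the maximum of $c^\top y$ over $c\in S$, $x\in X$, $y\in Y(x)$; let $T=[\underline t,\overline t]$, $\bar Y(x)=Y(x)\times T$, and $$h_f((y,t_f),c)=t_f+\tfrac1{1-\alpha_f}(c^\top y-t_f)^-,\qquad h_l((x,y,t_f,t_l),c)=t_l+\tfrac1{1-\alpha_l}(c^\top y-t_l)^+ .$$ **Problems.** The full-information problem is $$\textbf{[SI]}:\quad \min_{x,y}\ \rho_l(y,\mathbb Q^*)\quad\text{s.t. } x\in X,\ y\in\operatorname*{argmax}_{\tilde y\in Y(x)}\rho_f(\tilde y,\mathbb Q^*),$$ and the distributionally robust interdiction problem is $$\textbf{[DRI]}:\quad \min_{x,y}\ \max_{\mathbb Q\in\mathcal Q_l}\rho_l(y,\mathbb Q)\quad\text{s.t. } x\in X,\ y\in\operatorname*{argmax}_{\tilde y\in Y(x)}\min_{\mathbb Q\in\mathcal Q_f}\rho_f(\tilde y,\mathbb Q).$$ Their forms with explicit auxiliary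 variables are, respectively, $$\textbf{[SI}_t\textbf{]}:\quad z^*=\min\Big\{\mathbb E_{\mathbb Q^*}h_l(\bar x,c):\ \bar x=(x,y,t_f,t_l),\ x\in X,\ (y,t_f)\in V_f^*(x),\ t_l\in T\Big\},$$ $$\textbf{[DRI}_t\textbf{]}:\quad \hat z_l^*(k_l,k_f)=\min\Big\{\max_{\mathbb Q\in\mathcal Q_l}\mathbb E_{\mathbb Q}h_l(\bar x,c):\ \bar x=(x,y,t_f,t_l),\ x\in X,\ (y,t_f)\in \hat V_f(x),\ t_l\in T\Big\},$$ where $V_f^*(x)=\operatorname{argmax}_{\bar y\in\bar Y(x)}\mathbb E_{\mathbb Q^*}h_f(\bar y,c)$ and $\hat V_f(x)=\operatorname{argmax}_{\bar y\in\bar Y(x)}\min_{\mathbb Q\in\mathcal Q_f}\mathbb E_{\mathbb Q}h_f(\bar y,c)$. **Assumptions.** (A1) $X$ and, for each $x\in X$, $Y(x)$ are non-empty and bounded. (A2) $S$ is non-empty and compact. (A3) The data sets are as described above. (A4) For $i\in\{l,f\}$ there are levels $\theta_i(k)\in(0,1)$ with $\sum_k\theta_i(k)<\infty$ such that $\varepsilon_i(k)\ge0$,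 $\varepsilon_i(k)\to0$ as $k\to\infty$, and, for every sample size $k_i=k\ge1$, $\mathbb Q^*\in\mathcal Q_i$ with probability at least $1-\theta_i(k)$. (A5) For every $x\in X$ the set $V_f^*(x)$ has exactly one element. **Theorem 2.** Under A1–A5, [SI] and [SI$_t$] have optimal solutions and the same optimal value $z^*$. $\mathbb Q^{*\infty}$-almost surely, [DRI] and [DRI$_t$] have optimal solutions for all $1\le k_f\le k_l$, and $$\limsup_{k_f\to\infty}\ \limsup_{k_l\to\infty}\ \hat z_l^*(k_l,k_f)=z^* .$$ Moreover, $\mathbb Q^{*\infty}$-almost surely, for every choice of optimal solutions $\bar x^*(k_l,k_f)$ of [DRI$_t$], $1\le k_f\le k_l$, every accumulation point of $\{\bar x^*(k_l,k_f)\}$ as $k_l,k_f\to\infty$ (in particular, every iterated accumulation point, first in $k_l$ and then in $k_f$) is an optimal solution of [SI$_t$]. The same two assertions hold for the optimal values and the optimal solutions $(x,y)$ of [DRI], with limit problem [SI]. -/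

import Mathlib

open MeasureTheory Filter Topology Matrix Set
open scoped ENNReal

namespace DRI

noncomputable section

/-- Minimizers of `f` over `s`. -/
def argminOn {α : Type*} (f : α → EReal) (s : Set α) : Set α := {a | a ∈ s ∧ ∀ b ∈ s, f a ≤ f b}

/-- Maximizers of `f` over `s`. -/
def argmaxOn {α : Type*} (f : α → EReal) (s : Set α) : Set α := {a | a ∈ s ∧ ∀ b ∈ s, f b ≤ f a}

/-- Optimal value of the minimization of `f` over `s` (as an extended real). -/
def minValue {α : Type*} (f : α → EReal) (s : Set α) : EReal := ⨅ a ∈ s, f a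

/-- Deterministic data of the interdiction problem: the constraint matrices and right-hand sides
of the leader (`H`, `h`), the follower (`F`, `L`, `f`) and the support set (`B`, `b`), the
confidence levels, and the exponent `p` of the norm used in the Wasserstein distance. -/
structure Model (m n mX mY mS : ℕ) where
  H : Matrix (Fin mX) (Fin m) ℝ
  h : Fin mX → ℝ
  F : Matrix (Fin mY) (Fin n) ℝ
  L : Matrix (Fin mY) (Fin m) ℝ
  f : Fin mY → ℝ
  B : Matrix (Fin mS) (Fin n) ℝ
  b : Fin mS → ℝ
  alphaL : ℝ
  alphaF : ℝ
  p : ℝ≥0∞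

/-- All probability distributions on `S ⊆ ℝⁿ`, as measures on `ℝⁿ` concentrated on `S`. -/
def distributions {n : ℕ} (S : Set (Fin n → ℝ)) : Set (Measure (Fin n → ℝ)) :=
  {Q | IsProbabilityMeasure Q ∧ Q Sᶜ = 0}

/-- Couplings of `P` and `Q`. -/
def couplings {n : ℕ} (P Q : Measure (Fin n → ℝ)) :
    Set (Measure ((Fin n → ℝ) × (Fin n → ℝ))) :=
  {π | π.map Prod.fst = P ∧ π.map Prod.snd = Q}

/-- Type-1 Wasserstein distance with respect to the `ℓ_p`-norm. -/
def wasserstein {n : ℕ} (p : ℝ≥0∞) (P Q : Measure (Fin n → ℝ)) : ℝ≥0∞ :=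
  ⨅ π ∈ couplings P Q, ∫⁻ z, ENNReal.ofReal ‖WithLp.toLp p (z.1 - z.2)‖ ∂π

/-- Empirical distribution of the first `k` samples of the sequence `w`. -/
def empirical {n : ℕ} (w : ℕ → Fin n → ℝ) (k : ℕ) : Measure (Fin n → ℝ) :=
  (k : ℝ≥0∞)⁻¹ • ∑ i ∈ Finset.range k, Measure.dirac (w i)

/-- Right-tail conditional value-at-risk of `cᵀy`, `c ∼ Q`. -/
def rhoL {n : ℕ} (alpha : ℝ) (y : Fin n → ℝ) (Q : Measure (Fin n → ℝ)) : EReal :=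
  ⨅ t : ℝ, ((t + 1 / (1 - alpha) * ∫ c, max (c ⬝ᵥ y - t) 0 ∂Q : ℝ) : EReal)

/-- Left-tail conditional value-at-risk of `cᵀy`, `c ∼ Q`. -/
def rhoF {n : ℕ} (alpha : ℝ) (y : Fin n → ℝ) (Q : Measure (Fin n → ℝ)) : EReal :=
  ⨆ t : ℝ, ((t + 1 / (1 - alpha) * ∫ c, min (c ⬝ᵥ y - t) 0 ∂Q : ℝ) : EReal)

namespace Model

variable {m n mX mY mS : ℕ} (M : Model m n mX mY mS)

/-- The leader's feasible set `X`. -/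
def X : Set (Fin m → ℝ) := {x | (∀ i, x i = 0 ∨ x i = 1) ∧ M.H *ᵥ x ≤ M.h}

/-- The follower's feasible set `Y(x)`. -/
def Y (x : Fin m → ℝ) : Set (Fin n → ℝ) := {y | 0 ≤ y ∧ M.F *ᵥ y + M.L *ᵥ x ≤ M.f}

/-- The support set `S`. -/
def S : Set (Fin n → ℝ) := {c | M.B *ᵥ c ≤ M.b}

/-- Wasserstein ball of radius `eps` in the space of distributions on `S`, centered at the
empirical distribution of the first `k` samples of `w`. -/
def ambiguitySet (eps : ℝ) (w : ℕ → Fin n → ℝ) (k : ℕ) : Set (Measure (Fin n → ℝ)) :=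
  {Q | Q ∈ distributions M.S ∧ wasserstein M.p (empirical w k) Q ≤ ENNReal.ofReal eps}

/-- The radii `eps k` are valid for the significance levels `theta k`: the true distribution
lies in the ambiguity set built from `k` i.i.d. samples with probability at least `1 - theta k`,
that is, it fails to do so with probability at most `theta k`; the levels are summable and the
radii vanish as the sample size grows. -/
structure ValidRadii (Q : Measure (Fin n → ℝ)) [IsProbabilityMeasure Q] (theta eps : ℕ → ℝ) :
    Prop where
  theta_mem : ∀ k, 1 ≤ k → theta k ∈ Ioo (0 : ℝ) 1
  eps_nonneg : ∀ k, 1 ≤ k → 0 ≤ eps k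
  confidence : ∀ k, 1 ≤ k →
    Measure.infinitePi (fun _ : ℕ => Q) {w | Q ∉ M.ambiguitySet (eps k) w k} ≤
      ENNReal.ofReal (theta k)
  summable : Summable theta
  tendsto : Tendsto eps atTop (𝓝 0)

/-! ### The problems over `(x, y)` -/

/-- Feasible pairs `(x, y)` of the full information bilevel problem. -/
def feasibleSI (Q : Measure (Fin n → ℝ)) : Set ((Fin m → ℝ) × (Fin n → ℝ)) :=
  {z | z.1 ∈ M.X ∧ z.2 ∈ argmaxOn (fun y => rhoF M.alphaF y Q) (M.Y z.1)}

/-- The leader's objective in the full information bilevel problem. -/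
def objSI (Q : Measure (Fin n → ℝ)) (z : (Fin m → ℝ) × (Fin n → ℝ)) : EReal :=
  rhoL M.alphaL z.2 Q

/-- Feasible pairs `(x, y)` of the distributionally robust problem with follower's ambiguity
set `QF`. -/
def feasibleDRI (QF : Set (Measure (Fin n → ℝ))) : Set ((Fin m → ℝ) × (Fin n → ℝ)) :=
  {z | z.1 ∈ M.X ∧ z.2 ∈ argmaxOn (fun y => ⨅ Q ∈ QF, rhoF M.alphaF y Q) (M.Y z.1)}

/-- The leader's worst-case risk over the ambiguity set `QL`. -/
def objDRI (QL : Set (Measure (Fin n → ℝ))) (z : (Fin m → ℝ) × (Fin n → ℝ)) : EReal :=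
  ⨆ Q ∈ QL, rhoL M.alphaL z.2 Q

/-! ### The problems with the auxiliary variables `t_f` and `t_l` -/

/-- All values `cᵀy` with `c ∈ S` and `y ∈ Y(x)` for some `x ∈ X`. -/
def profits : Set ℝ := {r | ∃ x ∈ M.X, ∃ c ∈ M.S, ∃ y ∈ M.Y x, r = c ⬝ᵥ y}

/-- Range of the auxiliary variables `t_f` and `t_l`. -/
def tRange : Set ℝ := Icc (sInf M.profits) (sSup M.profits)

/-- Integrand of the follower at `(y, t_f)`. -/
def hF (yt : (Fin n → ℝ) × ℝ) (c : Fin n → ℝ) : ℝ :=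
  yt.2 + 1 / (1 - M.alphaF) * min (c ⬝ᵥ yt.1 - yt.2) 0

/-- Integrand of the leader at `(x, (y, t_f), t_l)`. -/
def hL (xb : (Fin m → ℝ) × ((Fin n → ℝ) × ℝ) × ℝ) (c : Fin n → ℝ) : ℝ :=
  xb.2.2 + 1 / (1 - M.alphaL) * max (c ⬝ᵥ xb.2.1.1 - xb.2.2) 0

/-- The extended follower's feasible set `Y(x) × [t_min, t_max]`. -/
def Ybar (x : Fin m → ℝ) : Set ((Fin n → ℝ) × ℝ) := M.Y x ×ˢ M.tRange

/-- Optimal solutions of the follower's full information problem. -/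
def VStar (Q : Measure (Fin n → ℝ)) (x : Fin m → ℝ) : Set ((Fin n → ℝ) × ℝ) :=
  argmaxOn (fun yt => ((∫ c, M.hF yt c ∂Q : ℝ) : EReal)) (M.Ybar x)

/-- Optimal solutions of the follower's robust problem with ambiguity set `QF`. -/
def VHat (QF : Set (Measure (Fin n → ℝ))) (x : Fin m → ℝ) : Set ((Fin n → ℝ) × ℝ) :=
  argmaxOn (fun yt => ⨅ Q ∈ QF, ((∫ c, M.hF yt c ∂Q : ℝ) : EReal)) (M.Ybar x)

/-- Feasible points `(x, (y, t_f), t_l)` of the leader's problem when the follower's set of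
optimal solutions is `V x`. -/
def Xbar (V : (Fin m → ℝ) → Set ((Fin n → ℝ) × ℝ)) :
    Set ((Fin m → ℝ) × ((Fin n → ℝ) × ℝ) × ℝ) :=
  {xb | xb.1 ∈ M.X ∧ xb.2.1 ∈ V xb.1 ∧ xb.2.2 ∈ M.tRange}

/-- The leader's full information objective. -/
def objStar (Q : Measure (Fin n → ℝ)) (xb : (Fin m → ℝ) × ((Fin n → ℝ) × ℝ) × ℝ) : EReal :=
  ((∫ c, M.hL xb c ∂Q : ℝ) : EReal)

/-- The leader's worst-case expected objective over the ambiguity set `QL`. -/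
def objHat (QL : Set (Measure (Fin n → ℝ))) (xb : (Fin m → ℝ) × ((Fin n → ℝ) × ℝ) × ℝ) :
    EReal :=
  ⨆ Q ∈ QL, ((∫ c, M.hL xb c ∂Q : ℝ) : EReal)

end Model

/-- `a` is an accumulation point of the double sequence `u kl kf`, `kf ≤ kl`, as both indices
tend to infinity. In particular this covers iterated accumulation points, first in `kl` and then
in `kf`. -/
def IsAccumulationPoint {α : Type*} [TopologicalSpace α] (a : α) (u : ℕ → ℕ → α) : Prop :=
  MapClusterPt a ((atTop ×ˢ atTop) ⊓ 𝓟 {k : ℕ × ℕ | k.2 ≤ k.1}) (fun k => u k.1 k.2)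

end

end DRI

/-! Two members of a Wasserstein ball differ, on a function of `c` with Lipschitz constant `K`, by
at most `2 * K * eps`. The integrands `h_f`, `h_l` are Lipschitz in `c` with a constant proportional
to `‖y‖`, hence uniformly so on bounded sets of decisions, and this passes to the suprema and infima
over `t` that define the two risks. By Borel–Cantelli the true law almost surely lies in all but
finitely many balls. Since the radii vanish, the worst-case objectives then converge uniformly on
bounded sets to the true ones.

For fixed `x` the follower's limit problem has a unique solution, so the robust solution sets shrink
to it (`isStableLimit_argmaxOn`). As `X` is finite, this is uniform in `x`, and the leader's
feasible sets converge in the Hausdorff sense. Minimization is stable under uniform convergence of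
objectives and Hausdorff convergence of compact feasible sets (`minimization_stability`). The
indices `kl` and `kf` enter separately, so the optimal values have a joint limit, stronger than the
iterated limsup.

The problems with and without auxiliary variables are two instances of `bilevel_stability`, so
minimum over laws and maximum over `t` are never exchanged. The two formulations are linked only
under the true law: clamping `t` to `T` never worsens an integrand, so optimal `t` exist in `T`. -/

namespace DRI

/-! ### Extrema of real families as extended reals -/

theorem biInf_coe_eq {ι : Type*} {s : Set ι} {g : ι → ℝ} (hs : s.Nonempty)
    (hb : BddBelow (g '' s)) : ⨅ i ∈ s, (g i : EReal) = ((sInf (g '' s) : ℝ) : EReal) := by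
  refine le_antisymm (le_of_forall_gt fun c hc => ?_) (le_iInf₂ fun i hi => ?_)
  · obtain ⟨r, h1, h2⟩ := EReal.lt_iff_exists_real_btwn.1 hc
    obtain ⟨_, ⟨i, hi, rfl⟩, hir⟩ := exists_lt_of_csInf_lt (hs.image g) (EReal.coe_lt_coe_iff.1 h1)
    exact ((iInf₂_le i hi).trans (EReal.coe_le_coe_iff.2 hir.le)).trans_lt h2
  · exact EReal.coe_le_coe_iff.2 (csInf_le hb ⟨i, hi, rfl⟩)

theorem biSup_coe_eq {ι : Type*} {s : Set ι} {g : ι → ℝ} (hs : s.Nonempty)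
    (hb : BddAbove (g '' s)) : ⨆ i ∈ s, (g i : EReal) = ((sSup (g '' s) : ℝ) : EReal) := by
  refine le_antisymm (iSup₂_le fun i hi => ?_) (le_of_forall_lt fun c hc => ?_)
  · exact EReal.coe_le_coe_iff.2 (le_csSup hb ⟨i, hi, rfl⟩)
  · obtain ⟨r, h1, h2⟩ := EReal.lt_iff_exists_real_btwn.1 hc
    obtain ⟨_, ⟨i, hi, rfl⟩, hir⟩ := exists_lt_of_lt_csSup (hs.image g) (EReal.coe_lt_coe_iff.1 h2)
    exact h1.trans_le ((EReal.coe_le_coe_iff.2 hir.le).trans (le_iSup₂ (f := fun i _ => (g i : EReal)) i hi))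

/-- Infima are nonexpansive for the uniform distance. This serves twice: for continuity in the
decision, and, with `g'` constant, for closeness to the true value. -/
theorem abs_sInf_image_sub_le {ι : Type*} {s : Set ι} {g g' : ι → ℝ} {d : ℝ} (hs : s.Nonempty)
    (hb : BddBelow (g '' s)) (hb' : BddBelow (g' '' s)) (h : ∀ i ∈ s, |g i - g' i| ≤ d) :
    |sInf (g '' s) - sInf (g' '' s)| ≤ d := by
  rw [abs_le]
  constructor
  · have : sInf (g' '' s) - d ≤ sInf (g '' s) := le_csInf (hs.image g) <| by
      rintro _ ⟨i, hi, rfl⟩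
      linarith [csInf_le hb' ⟨i, hi, rfl⟩, (abs_le.1 (h i hi)).1]
    linarith
  · have : sInf (g '' s) - d ≤ sInf (g' '' s) := le_csInf (hs.image g') <| by
      rintro _ ⟨i, hi, rfl⟩
      linarith [csInf_le hb ⟨i, hi, rfl⟩, (abs_le.1 (h i hi)).2]
    linarith

theorem abs_sSup_image_sub_le {ι : Type*} {s : Set ι} {g g' : ι → ℝ} {d : ℝ} (hs : s.Nonempty)
    (hb : BddAbove (g '' s)) (hb' : BddAbove (g' '' s)) (h : ∀ i ∈ s, |g i - g' i| ≤ d) :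
    |sSup (g '' s) - sSup (g' '' s)| ≤ d := by
  rw [abs_le]
  constructor
  · have : sSup (g' '' s) ≤ sSup (g '' s) + d := csSup_le (hs.image g') <| by
      rintro _ ⟨i, hi, rfl⟩
      linarith [le_csSup hb ⟨i, hi, rfl⟩, (abs_le.1 (h i hi)).1]
    linarith
  · have : sSup (g '' s) ≤ sSup (g' '' s) + d := csSup_le (hs.image g) <| by
      rintro _ ⟨i, hi, rfl⟩
      linarith [le_csSup hb' ⟨i, hi, rfl⟩, (abs_le.1 (h i hi)).2]
    linarith

theorem minValue_eq_of_mem_argminOn {α : Type*} {f : α → EReal} {s : Set α} {a : α}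
    (ha : a ∈ argminOn f s) : minValue f s = f a :=
  le_antisymm (iInf₂_le a ha.1) (le_iInf₂ ha.2)

theorem argmaxOn_coe_nonempty {α : Type*} [TopologicalSpace α] {f : α → ℝ} {s : Set α}
    (hs : IsCompact s) (hne : s.Nonempty) (hf : Continuous f) :
    (argmaxOn (fun a => (f a : EReal)) s).Nonempty := by
  obtain ⟨a, ha, h⟩ := hs.exists_isMaxOn hne hf.continuousOn
  exact ⟨a, ha, fun b hb => EReal.coe_le_coe_iff.2 (h hb)⟩

theorem argminOn_coe_nonempty {α : Type*} [TopologicalSpace α] {f : α → ℝ} {s : Set α}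
    (hs : IsCompact s) (hne : s.Nonempty) (hf : Continuous f) :
    (argminOn (fun a => (f a : EReal)) s).Nonempty := by
  obtain ⟨a, ha, h⟩ := hs.exists_isMinOn hne hf.continuousOn
  exact ⟨a, ha, fun b hb => EReal.coe_le_coe_iff.2 (h hb)⟩

theorem isCompact_argmaxOn_coe {α : Type*} [TopologicalSpace α] {f : α → ℝ} {s : Set α}
    (hs : IsCompact s) (hf : Continuous f) :
    IsCompact (argmaxOn (fun a => (f a : EReal)) s) := by
  have : argmaxOn (fun a => (f a : EReal)) s = s ∩ ⋂ b ∈ s, {a | f b ≤ f a} := by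
    ext a; simp [argmaxOn]
  rw [this]
  exact hs.inter_right (isClosed_biInter fun b _ => isClosed_le continuous_const hf)

/-! ### Stability of maximizers and of minimization problems -/

/-- Maximizers of uniformly convergent objectives approach the unique maximizer of the limit. -/
theorem eventually_dist_argmaxOn_lt {E : Type*} [PseudoMetricSpace E] {K : Set E}
    (hK : IsCompact K) {f : E → ℝ} (hf : Continuous f) {g : ℕ → E → ℝ}
    (hg : ∀ e > 0, ∀ᶠ k in atTop, ∀ a ∈ K, |g k a - f a| ≤ e) {a : E} (ha : a ∈ K)
    (hmax : ∀ b ∈ K, f b ≤ f a) (huniq : ∀ b ∈ K, f a ≤ f b → b = a) {e : ℝ} (he : 0 < e) :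
    ∀ᶠ k in atTop, ∀ b ∈ argmaxOn (fun x => (g k x : EReal)) K, dist b a < e := by
  have hK' : IsCompact (K \ Metric.ball a e) := hK.diff Metric.isOpen_ball
  rcases (K \ Metric.ball a e).eq_empty_or_nonempty with h | h
  · exact Eventually.of_forall fun k b hb => by
      by_contra hd
      exact h.subset ⟨hb.1, hd⟩
  · obtain ⟨c, hc, hcmax⟩ := hK'.exists_isMaxOn h hf.continuousOn
    have hlt : f c < f a := by
      refine lt_of_le_of_ne (hmax c hc.1) fun heq => hc.2 ?_
      rw [huniq c hc.1 heq.ge]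
      exact Metric.mem_ball_self he
    -- `f a - f c` is the gap between the maximum and the best value outside the ball. Two errors of
    -- a third of it cannot reverse the order.
    filter_upwards [hg ((f a - f c) / 3) (by linarith)] with k hk b hb
    by_contra hd
    have h1 : f b ≤ f c := hcmax (⟨hb.1, hd⟩ : b ∈ K \ Metric.ball a e)
    have h2 : g k a ≤ g k b := EReal.coe_le_coe_iff.1 (hb.2 a ha)
    linarith [(abs_le.1 (hk a ha)).1, (abs_le.1 (hk b hb.1)).2]

/-- The bounds hold jointly in both indices, so each inner limsup is already within `e` of `r`. -/
theorem limsup_limsup_coe_eq {v : ℕ → ℕ → EReal} {r : ℝ}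
    (h : ∀ e > 0, ∃ N, ∀ kl kf, N ≤ kl → N ≤ kf →
      ((r - e : ℝ) : EReal) ≤ v kl kf ∧ v kl kf ≤ ((r + e : ℝ) : EReal)) :
    limsup (fun kf => limsup (fun kl => v kl kf) atTop) atTop = (r : EReal) := by
  have key : ∀ e > 0, ∀ᶠ kf in atTop,
      ((r - e : ℝ) : EReal) ≤ limsup (fun kl => v kl kf) atTop ∧
        limsup (fun kl => v kl kf) atTop ≤ ((r + e : ℝ) : EReal) := by
    intro e he
    obtain ⟨N, hN⟩ := h e he
    filter_upwards [eventually_ge_atTop N] with kf hkf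
    constructor
    · refine le_limsup_of_le (by isBoundedDefault) fun b hb => ?_
      obtain ⟨kl, h1, h2⟩ := (hb.and (eventually_ge_atTop N)).exists
      exact (hN kl kf h2 hkf).1.trans h1
    · refine limsup_le_of_le (by isBoundedDefault) ?_
      filter_upwards [eventually_ge_atTop N] with kl hkl
      exact (hN kl kf hkl hkf).2
  refine Tendsto.limsup_eq (tendsto_order.2 ⟨fun a ha => ?_, fun a ha => ?_⟩)
  · obtain ⟨q, h1, h2⟩ := EReal.lt_iff_exists_real_btwn.1 ha
    filter_upwards [key (r - q) (sub_pos.2 (EReal.coe_lt_coe_iff.1 h2))] with kf hkf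
    rw [sub_sub_cancel] at hkf
    exact h1.trans_le hkf.1
  · obtain ⟨q, h1, h2⟩ := EReal.lt_iff_exists_real_btwn.1 ha
    filter_upwards [key (q - r) (sub_pos.2 (EReal.coe_lt_coe_iff.1 h1))] with kf hkf
    rw [add_sub_cancel] at hkf
    exact hkf.2.trans_lt h2

/-- The sets `F k`, `k ≥ 1`, and `Fs` are compact and non-empty, and `F k` tends to `Fs` in the
Hausdorff sense. -/
structure IsStableLimit {α : Type*} [PseudoMetricSpace α] (Fs : Set α) (F : ℕ → Set α) : Prop where
  isCompact_lim : IsCompact Fs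
  nonempty_lim : Fs.Nonempty
  isCompact : ∀ k, 1 ≤ k → IsCompact (F k)
  nonempty : ∀ k, 1 ≤ k → (F k).Nonempty
  outer : ∀ e > 0, ∀ᶠ k in atTop, ∀ a ∈ F k, ∃ b ∈ Fs, dist a b < e
  inner : ∀ e > 0, ∀ᶠ k in atTop, ∀ b ∈ Fs, ∃ a ∈ F k, dist a b < e

/-- The limit set is a singleton, so closeness of all approximate maximizers to it gives both halves
of Hausdorff convergence. Without uniqueness the inner half can fail. -/
theorem isStableLimit_argmaxOn {E : Type*} [PseudoMetricSpace E] {K : Set E}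
    (hK : IsCompact K) (hKne : K.Nonempty) {f : E → ℝ} (hf : Continuous f) {g : ℕ → E → ℝ}
    (hgc : ∀ k, 1 ≤ k → Continuous (g k))
    (hg : ∀ e > 0, ∀ᶠ k in atTop, ∀ a ∈ K, |g k a - f a| ≤ e)
    {Φs : E → EReal} {Φ : ℕ → E → EReal} (hΦs : ∀ a, Φs a = f a)
    (hΦ : ∀ k, 1 ≤ k → ∀ a, Φ k a = g k a) (huniq : ∃! a, a ∈ argmaxOn Φs K) :
    IsStableLimit (argmaxOn Φs K) fun k => argmaxOn (Φ k) K := by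
  obtain rfl : Φs = fun a => (f a : EReal) := funext hΦs
  have hΦ' : ∀ k, 1 ≤ k → Φ k = fun a => (g k a : EReal) := fun k hk => funext (hΦ k hk)
  have hne : ∀ k, 1 ≤ k → (argmaxOn (Φ k) K).Nonempty := fun k hk => by
    rw [hΦ' k hk]; exact argmaxOn_coe_nonempty hK hKne (hgc k hk)
  obtain ⟨a, ha, hau⟩ := huniq
  have hconv : ∀ e > 0, ∀ᶠ k in atTop, ∀ b ∈ argmaxOn (Φ k) K, dist b a < e := fun e he => by
    filter_upwards [eventually_ge_atTop 1, eventually_dist_argmaxOn_lt hK hf hg ha.1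
      (fun b hb => EReal.coe_le_coe_iff.1 (ha.2 b hb))
      (fun b hb hab => hau b ⟨hb, fun c hc => (ha.2 c hc).trans (EReal.coe_le_coe_iff.2 hab)⟩) he]
      with k hk h
    rwa [hΦ' k hk]
  refine ⟨isCompact_argmaxOn_coe hK hf, ⟨a, ha⟩, fun k hk => ?_, hne, fun e he => ?_, fun e he => ?_⟩
  · rw [hΦ' k hk]; exact isCompact_argmaxOn_coe hK (hgc k hk)
  · filter_upwards [hconv e he] with k hk b hb using ⟨a, ha, hk b hb⟩
  · filter_upwards [hconv e he, eventually_ge_atTop 1] with k hk hk1 b hb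
    obtain rfl := hau b hb
    obtain ⟨c, hc⟩ := hne k hk1
    exact ⟨c, hc, hk c hc⟩

theorem IsStableLimit.prod_const {α β : Type*} [PseudoMetricSpace α] [PseudoMetricSpace β]
    {Fs : Set α} {F : ℕ → Set α} (h : IsStableLimit Fs F) {T : Set β} (hT : IsCompact T)
    (hTne : T.Nonempty) : IsStableLimit (Fs ×ˢ T) fun k => F k ×ˢ T where
  isCompact_lim := h.isCompact_lim.prod hT
  nonempty_lim := h.nonempty_lim.prod hTne
  isCompact k hk := (h.isCompact k hk).prod hT
  nonempty k hk := (h.nonempty k hk).prod hTne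
  outer e he := by
    filter_upwards [h.outer e he] with k hk a ha
    obtain ⟨b, hb, hab⟩ := hk a.1 ha.1
    exact ⟨(b, a.2), ⟨hb, ha.2⟩, by simpa [Prod.dist_eq, he] using hab⟩
  inner e he := by
    filter_upwards [h.inner e he] with k hk b hb
    obtain ⟨a, ha, hab⟩ := hk b.1 hb.1
    exact ⟨(a, b.2), ⟨ha, hb.2⟩, by simpa [Prod.dist_eq, he] using hab⟩

/-- Pairs of a leader's decision in `X` and a response in `V x`. -/
def bilevelPairs {α β : Type*} (X : Set α) (V : α → Set β) : Set (α × β) :=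
  {z | z.1 ∈ X ∧ z.2 ∈ V z.1}

theorem isCompact_bilevelPairs {α β : Type*} [TopologicalSpace α] [TopologicalSpace β]
    {X : Set α} (hX : X.Finite) {V : α → Set β} (hV : ∀ x ∈ X, IsCompact (V x)) :
    IsCompact (bilevelPairs X V) := by
  have : bilevelPairs X V = ⋃ x ∈ X, {x} ×ˢ V x := by
    ext ⟨x, y⟩
    simp only [bilevelPairs, mem_ofPred_eq, mem_iUnion, mem_prod, mem_singleton_iff]
    exact ⟨fun h => ⟨x, h.1, rfl, h.2⟩, by rintro ⟨_, h, rfl, h'⟩; exact ⟨h, h'⟩⟩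
  rw [this]
  exact hX.isCompact_biUnion fun x hx => isCompact_singleton.prod (hV x hx)

theorem bilevelPairs_nonempty {α β : Type*} {X : Set α} (hX : X.Nonempty) {V : α → Set β}
    (hV : ∀ x ∈ X, (V x).Nonempty) : (bilevelPairs X V).Nonempty :=
  let ⟨x, hx⟩ := hX
  let ⟨y, hy⟩ := hV x hx
  ⟨(x, y), hx, hy⟩

/-- Finiteness of `X` makes the approximations simultaneous in `x`; the leader's component is left
unchanged. -/
theorem isStableLimit_bilevelPairs {α β : Type*} [PseudoMetricSpace α] [PseudoMetricSpace β]
    {X : Set α} (hX : X.Finite) (hXne : X.Nonempty) {Vs : α → Set β} {V : ℕ → α → Set β}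
    (h : ∀ x ∈ X, IsStableLimit (Vs x) fun k => V k x) :
    IsStableLimit (bilevelPairs X Vs) fun k => bilevelPairs X (V k) where
  isCompact_lim := isCompact_bilevelPairs hX fun x hx => (h x hx).isCompact_lim
  nonempty_lim := bilevelPairs_nonempty hXne fun x hx => (h x hx).nonempty_lim
  isCompact k hk := isCompact_bilevelPairs hX fun x hx => (h x hx).isCompact k hk
  nonempty k hk := bilevelPairs_nonempty hXne fun x hx => (h x hx).nonempty k hk
  outer e he := by
    filter_upwards [(hX.eventually_all).2 fun x hx => (h x hx).outer e he] with k hk z hz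
    obtain ⟨b, hb, hab⟩ := hk z.1 hz.1 z.2 hz.2
    exact ⟨(z.1, b), ⟨hz.1, hb⟩, by simpa [Prod.dist_eq, he] using hab⟩
  inner e he := by
    filter_upwards [(hX.eventually_all).2 fun x hx => (h x hx).inner e he] with k hk z hz
    obtain ⟨a, ha, hab⟩ := hk z.1 hz.1 z.2 hz.2
    exact ⟨(z.1, a), ⟨hz.1, ha⟩, by simpa [Prod.dist_eq, he] using hab⟩

/-- Stability of a minimization problem whose objective converges uniformly and whose feasible
sets converge in the Hausdorff sense. -/
theorem minimization_stability {α : Type*} [MetricSpace α] {Fs D : Set α} {F : ℕ → Set α}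
    {fs : α → ℝ} {f : ℕ → α → ℝ} {Ψs : α → EReal} {Ψ : ℕ → α → EReal}
    (hΨs : ∀ a, Ψs a = fs a) (hΨ : ∀ k, 1 ≤ k → ∀ a, Ψ k a = f k a)
    (hF : IsStableLimit Fs F) (hFD : ∀ k, 1 ≤ k → F k ⊆ D)
    (hfs : UniformContinuous fs) (hf : ∀ k, 1 ≤ k → Continuous (f k))
    (hunif : ∀ e > 0, ∀ᶠ k in atTop, ∀ a ∈ D, |f k a - fs a| ≤ e) :
    (∀ kl kf : ℕ, 1 ≤ kf → kf ≤ kl → (argminOn (Ψ kl) (F kf)).Nonempty) ∧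
    limsup (fun kf : ℕ => limsup (fun kl : ℕ => minValue (Ψ kl) (F kf)) atTop) atTop =
      minValue Ψs Fs ∧
    (∀ u : ℕ → ℕ → α, (∀ kl kf : ℕ, 1 ≤ kf → kf ≤ kl → u kl kf ∈ argminOn (Ψ kl) (F kf)) →
      ∀ a, IsAccumulationPoint a u → a ∈ argminOn Ψs Fs) := by
  obtain rfl : Ψs = fun a => (fs a : EReal) := funext hΨs
  have hne : ∀ kl kf : ℕ, 1 ≤ kl → 1 ≤ kf → (argminOn (Ψ kl) (F kf)).Nonempty := by
    intro kl kf hkl hkf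
    rw [show Ψ kl = fun a => (f kl a : EReal) from funext (hΨ kl hkl)]
    exact argminOn_coe_nonempty (hF.isCompact kf hkf) (hF.nonempty kf hkf) (hf kl hkl)
  obtain ⟨as, has⟩ := argminOn_coe_nonempty hF.isCompact_lim hF.nonempty_lim hfs.continuous
  have hmin : ∀ b ∈ Fs, fs as ≤ fs b := fun b hb => EReal.coe_le_coe_iff.1 (has.2 b hb)
  have key : ∀ e > 0, ∃ N, 1 ≤ N ∧ ∀ kl kf, N ≤ kl → N ≤ kf → ∀ a ∈ argminOn (Ψ kl) (F kf),
      fs as - e ≤ f kl a ∧ f kl a ≤ fs as + e ∧ |f kl a - fs a| ≤ e := by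
    intro e he
    obtain ⟨d, hd, hfd⟩ := Metric.uniformContinuous_iff.1 hfs (e / 2) (by linarith)
    -- The objective carries the index `kl` and the feasible set the index `kf`. Uniform closeness
    -- is therefore asked on `D`, which contains every `F kf`.
    obtain ⟨N, hN⟩ := eventually_atTop.1
      ((hunif (e / 2) (by linarith)).and ((hF.outer d hd).and (hF.inner d hd)))
    refine ⟨max N 1, le_max_right _ _, fun kl kf hkl hkf a ha => ?_⟩
    have hl1 : 1 ≤ kl := (le_max_right _ _).trans hkl
    have hf1 : 1 ≤ kf := (le_max_right _ _).trans hkf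
    have hu := (hN kl ((le_max_left _ _).trans hkl)).1
    obtain ⟨-, ho, hi⟩ := hN kf ((le_max_left _ _).trans hkf)
    have hua := hu a (hFD kf hf1 ha.1)
    obtain ⟨b, hb, hab⟩ := ho a ha.1
    -- The point `c` of `F kf` near the limit minimizer `as` is a competitor of `a` and gives the
    -- upper bound; the point `b` of `Fs` near `a` gives the lower one.
    obtain ⟨c, hc, hca⟩ := hi as has.1
    have huc := hu c (hFD kf hf1 hc)
    have h1 := abs_lt.1 (hfd hab)
    have h2 := abs_lt.1 (hfd hca)
    have h3 : f kl a ≤ f kl c := by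
      have := ha.2 c hc
      rwa [hΨ kl hl1, hΨ kl hl1, EReal.coe_le_coe_iff] at this
    have := hmin b hb
    refine ⟨?_, ?_, hua.trans (by linarith)⟩
    · linarith [(abs_le.1 hua).1]
    · linarith [(abs_le.1 huc).2]
  refine ⟨fun kl kf h1 h2 => hne kl kf (h1.trans h2) h1, ?_, ?_⟩
  · rw [minValue_eq_of_mem_argminOn has]
    refine limsup_limsup_coe_eq fun e he => ?_
    obtain ⟨N, hN1, hN⟩ := key e he
    refine ⟨N, fun kl kf hkl hkf => ?_⟩
    obtain ⟨a, ha⟩ := hne kl kf (hN1.trans hkl) (hN1.trans hkf)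
    rw [minValue_eq_of_mem_argminOn ha, hΨ kl (hN1.trans hkl), EReal.coe_le_coe_iff,
      EReal.coe_le_coe_iff]
    exact ⟨(hN kl kf hkl hkf a ha).1, (hN kl kf hkl hkf a ha).2.1⟩
  · intro u hu a ha
    have hfreq : ∀ N : ℕ, ∀ p : α → Prop, (∀ᶠ x in 𝓝 a, p x) →
        ∃ kl kf, N ≤ kl ∧ N ≤ kf ∧ kf ≤ kl ∧ p (u kl kf) := by
      intro N p hp
      have h1 : ∀ᶠ k : ℕ × ℕ in (atTop ×ˢ atTop) ⊓ 𝓟 {k : ℕ × ℕ | k.2 ≤ k.1},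
          (N ≤ k.1 ∧ N ≤ k.2) ∧ k.2 ≤ k.1 :=
        Eventually.and (Eventually.filter_mono inf_le_left
          ((eventually_ge_atTop N).prod_mk (eventually_ge_atTop N)))
          (Eventually.filter_mono inf_le_right (mem_principal_self _))
      obtain ⟨k, h2, h3⟩ := ((MapClusterPt.frequently ha hp).and_eventually h1).exists
      exact ⟨k.1, k.2, h3.1.1, h3.1.2, h3.2, h2⟩
    -- Arbitrarily late terms of `u` are near `a` and also near `Fs`, which is closed.
    have haF : a ∈ Fs := by
      rw [← hF.isCompact_lim.isClosed.closure_eq, Metric.mem_closure_iff]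
      intro e he
      obtain ⟨N, hN⟩ := eventually_atTop.1 (hF.outer (e / 2) (by linarith))
      obtain ⟨kl, kf, -, h2, h3, h4⟩ := hfreq (max N 1) (fun x => dist x a < e / 2)
        (Metric.ball_mem_nhds a (by linarith))
      obtain ⟨b, hb, hub⟩ := hN kf ((le_max_left _ _).trans h2) _
        (hu kl kf ((le_max_right _ _).trans h2) h3).1
      exact ⟨b, hb, by linarith [dist_triangle_left a b (u kl kf)]⟩
    refine ⟨haF, fun b hb => EReal.coe_le_coe_iff.2 (le_trans ?_ (hmin b hb))⟩
    refine le_of_forall_pos_le_add fun e he => ?_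
    obtain ⟨N, hN1, hN⟩ := key (e / 3) (by linarith)
    obtain ⟨kl, kf, h1, h2, h3, h4⟩ := hfreq N (fun x => dist (fs x) (fs a) < e / 3)
      (hfs.continuous.continuousAt.eventually (Metric.ball_mem_nhds _ (by linarith)))
    obtain ⟨-, h5, h6⟩ := hN kl kf h1 h2 _ (hu kl kf (hN1.trans h2) h3)
    linarith [(abs_lt.1 h4).1, (abs_le.1 h6).1]

variable {m n mX mY mS : ℕ}

/-! ### Wasserstein distance and expectations of Lipschitz functions -/

theorem abs_dotProduct_le_norm (c y : Fin n → ℝ) : |c ⬝ᵥ y| ≤ n * ‖c‖ * ‖y‖ := by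
  calc |c ⬝ᵥ y| ≤ ∑ i, |c i * y i| := Finset.abs_sum_le_sum_abs _ _
    _ ≤ ∑ _i : Fin n, ‖c‖ * ‖y‖ := Finset.sum_le_sum fun i _ => by
        rw [abs_mul]
        exact mul_le_mul (norm_le_pi_norm c i) (norm_le_pi_norm y i) (abs_nonneg _) (norm_nonneg _)
    _ = n * ‖c‖ * ‖y‖ := by simp [mul_assoc]

theorem integrable_of_mem_distributions {S : Set (Fin n → ℝ)} (hS : IsCompact S)
    {Q : Measure (Fin n → ℝ)} (hQ : Q ∈ distributions S) {g : (Fin n → ℝ) → ℝ}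
    (hg : Continuous g) : Integrable g Q := by
  have := hQ.1
  obtain ⟨C, hC⟩ := hS.exists_bound_of_continuousOn hg.continuousOn
  exact Integrable.of_bound hg.aestronglyMeasurable C
    (by filter_upwards [compl_mem_ae_iff.2 hQ.2] with c hc using hC c (by simpa using hc))

theorem ae_mem_of_mem_distributions {S : Set (Fin n → ℝ)}
    {Q : Measure (Fin n → ℝ)} (hQ : Q ∈ distributions S) : ∀ᵐ c ∂Q, c ∈ S := by
  filter_upwards [compl_mem_ae_iff.2 hQ.2] with c hc using by simpa using hc

/-- The norm of `Fin n → ℝ` is the sup norm, the smallest of the `ℓ_p` norms, so sup-norm Lipschitz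
bounds serve for every `p`. -/
theorem norm_le_norm_toLp {p : ℝ≥0∞} (hp : 1 ≤ p) (z : Fin n → ℝ) :
    ‖z‖ ≤ ‖WithLp.toLp p z‖ := by
  have : Fact (1 ≤ p) := ⟨hp⟩
  exact (pi_norm_le_iff_of_nonneg (norm_nonneg _)).2 fun i => PiLp.norm_apply_le (WithLp.toLp p z) i

/-- The easy half of Kantorovich duality: under any coupling, the difference of the means is the
integral of `g z.1 - g z.2`, which is at most `K` times the transport cost. -/
theorem abs_integral_sub_le_of_wasserstein_le {p : ℝ≥0∞} (hp : 1 ≤ p)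
    {P Q : Measure (Fin n → ℝ)} {g : (Fin n → ℝ) → ℝ} {K : ℝ} (hK : 0 ≤ K)
    (hg : Continuous g) (hlip : ∀ c c', |g c - g c'| ≤ K * ‖c - c'‖)
    (hP : Integrable g P) (hQ : Integrable g Q) {eps : ℝ} (heps : 0 ≤ eps)
    (hW : wasserstein p P Q ≤ ENNReal.ofReal eps) :
    |∫ c, g c ∂P - ∫ c, g c ∂Q| ≤ K * eps := by
  -- A factor `0` does not pass through an empty infimum in `ℝ≥0∞`, so the bound is shown for `K' >
  -- K` and then `K'` decreases to `K`.
  have hstep : ∀ K' : ℝ, K < K' → |∫ c, g c ∂P - ∫ c, g c ∂Q| ≤ K' * eps := by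
    intro K' hK'
    have hK0 : 0 < K' := hK.trans_lt hK'
    have h1 : ENNReal.ofReal |∫ c, g c ∂P - ∫ c, g c ∂Q| ≤
        ENNReal.ofReal K' * wasserstein p P Q := by
      unfold wasserstein
      rw [ENNReal.mul_iInf_of_ne (by simpa using hK0) ENNReal.ofReal_ne_top]
      refine le_iInf fun π => ?_
      rw [ENNReal.mul_iInf_of_ne (by simpa using hK0) ENNReal.ofReal_ne_top]
      refine le_iInf fun hπ => ?_
      have hi1 : Integrable (fun z : (Fin n → ℝ) × (Fin n → ℝ) => g z.1) π := by
        rw [← hπ.1] at hP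
        exact hP.comp_measurable measurable_fst
      have hi2 : Integrable (fun z : (Fin n → ℝ) × (Fin n → ℝ) => g z.2) π := by
        rw [← hπ.2] at hQ
        exact hQ.comp_measurable measurable_snd
      have e1 : ∫ c, g c ∂P = ∫ z, g z.1 ∂π := by
        rw [← hπ.1]
        exact integral_map measurable_fst.aemeasurable hg.aestronglyMeasurable
      have e2 : ∫ c, g c ∂Q = ∫ z, g z.2 ∂π := by
        rw [← hπ.2]
        exact integral_map measurable_snd.aemeasurable hg.aestronglyMeasurable
      rw [e1, e2, ← integral_sub hi1 hi2, ← Real.norm_eq_abs, ofReal_norm]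
      refine (enorm_integral_le_lintegral_enorm _).trans ?_
      rw [← lintegral_const_mul' _ _ ENNReal.ofReal_ne_top]
      refine lintegral_mono fun z => ?_
      rw [← ofReal_norm, ← ENNReal.ofReal_mul hK0.le]
      refine ENNReal.ofReal_le_ofReal ((hlip z.1 z.2).trans ?_)
      exact mul_le_mul hK'.le (norm_le_norm_toLp hp _) (norm_nonneg _) hK0.le
    have h2 := h1.trans (mul_le_mul_right hW (ENNReal.ofReal K'))
    rwa [← ENNReal.ofReal_mul hK0.le, ENNReal.ofReal_le_ofReal_iff (by positivity)] at h2
  have hlim : Tendsto (fun K' : ℝ => K' * eps) (𝓝[>] K) (𝓝 (K * eps)) :=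
    ((continuous_id.mul continuous_const).tendsto K).mono_left nhdsWithin_le_nhds
  exact ge_of_tendsto hlim (by filter_upwards [self_mem_nhdsWithin] with K' h using hstep K' h)

theorem wasserstein_self {p : ℝ≥0∞} (hp : 1 ≤ p) (P : Measure (Fin n → ℝ)) :
    wasserstein p P P = 0 := by
  have : Fact (1 ≤ p) := ⟨hp⟩
  have hd : Measurable (fun c : Fin n → ℝ => (c, c)) := measurable_id.prodMk measurable_id
  refine le_antisymm ((iInf₂_le (P.map fun c => (c, c)) ⟨?_, ?_⟩).trans ?_) bot_le
  · refine (lintegral_map_le _ _).trans ?_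
    simp
  · rw [Measure.map_map measurable_fst hd]; exact Measure.map_id
  · rw [Measure.map_map measurable_snd hd]; exact Measure.map_id

theorem empirical_mem_distributions {S : Set (Fin n → ℝ)} (hS : IsClosed S)
    {w : ℕ → Fin n → ℝ} (hw : ∀ i, w i ∈ S) {k : ℕ} (hk : 1 ≤ k) :
    empirical w k ∈ distributions S := by
  have hk0 : (k : ℝ≥0∞) ≠ 0 := by simpa using Nat.one_le_iff_ne_zero.1 hk
  refine ⟨⟨?_⟩, ?_⟩
  · simp [empirical, ENNReal.inv_mul_cancel hk0]
  · simp [empirical, Measure.dirac_apply' _ hS.measurableSet.compl, hw]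

/-! ### Wasserstein balls around the empirical distribution -/

namespace Model

variable {M : Model m n mX mY mS}

/-- Every ball with `k ≥ 1` is thus non-empty, also when it misses the true law; optimal solutions
then exist at all sample sizes. -/
theorem empirical_mem_ambiguitySet (hp : 1 ≤ M.p) (hSc : IsCompact M.S) {w : ℕ → Fin n → ℝ}
    (hw : ∀ i, w i ∈ M.S) {k : ℕ} (hk : 1 ≤ k) (eps : ℝ) :
    empirical w k ∈ M.ambiguitySet eps w k :=
  ⟨empirical_mem_distributions hSc.isClosed hw hk, by rw [wasserstein_self hp]; exact bot_le⟩

/-- Triangle inequality through the centre, whence the factor 2. -/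
theorem abs_integral_sub_le_of_mem_ambiguitySet (hp : 1 ≤ M.p) (hSc : IsCompact M.S)
    {w : ℕ → Fin n → ℝ} (hw : ∀ i, w i ∈ M.S) {k : ℕ} (hk : 1 ≤ k) {eps : ℝ} (heps : 0 ≤ eps)
    {Q Q' : Measure (Fin n → ℝ)} (hQ : Q ∈ M.ambiguitySet eps w k)
    (hQ' : Q' ∈ M.ambiguitySet eps w k) {g : (Fin n → ℝ) → ℝ} {K : ℝ} (hK : 0 ≤ K)
    (hg : Continuous g) (hlip : ∀ c c', |g c - g c'| ≤ K * ‖c - c'‖) :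
    |∫ c, g c ∂Q - ∫ c, g c ∂Q'| ≤ 2 * K * eps := by
  have hE := empirical_mem_distributions hSc.isClosed hw hk
  have hint := fun {P} (hP : P ∈ distributions M.S) => integrable_of_mem_distributions hSc hP hg
  have h1 := abs_le.1 (abs_integral_sub_le_of_wasserstein_le hp hK hg hlip (hint hE) (hint hQ.1)
    heps hQ.2)
  have h2 := abs_le.1 (abs_integral_sub_le_of_wasserstein_le hp hK hg hlip (hint hE) (hint hQ'.1)
    heps hQ'.2)
  rw [abs_le]
  constructor <;> linarith [h1.1, h1.2, h2.1, h2.2]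

/-- Almost surely, all samples lie in the support set. -/
theorem ae_forall_sample_mem (Q : Measure (Fin n → ℝ)) [IsProbabilityMeasure Q]
    (hQ : Q ∈ distributions M.S) :
    ∀ᵐ w ∂(Measure.infinitePi (fun _ : ℕ => Q)), ∀ i, w i ∈ M.S :=
  ae_all_iff.2 fun i => (measurePreserving_eval_infinitePi (fun _ : ℕ => Q) i).quasiMeasurePreserving.ae
    (ae_mem_of_mem_distributions hQ)

/-- Almost surely, the true distribution eventually lies in the ambiguity set. -/
theorem ValidRadii.ae_eventually_mem {Q : Measure (Fin n → ℝ)} [IsProbabilityMeasure Q]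
    {theta eps : ℕ → ℝ} (h : M.ValidRadii Q theta eps) :
    ∀ᵐ w ∂(Measure.infinitePi (fun _ : ℕ => Q)), ∀ᶠ k in atTop, Q ∈ M.ambiguitySet (eps k) w k := by
  -- The first Borel–Cantelli lemma is applied with a shift by one, since the confidence bound
  -- starts at `k = 1`.
  have hsum : ∑' k, Measure.infinitePi (fun _ : ℕ => Q)
      {w | Q ∉ M.ambiguitySet (eps (k + 1)) w (k + 1)} ≠ ⊤ := by
    refine ne_top_of_le_ne_top ((summable_nat_add_iff 1).2 h.summable).tsum_ofReal_ne_top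
      (ENNReal.tsum_le_tsum fun k => h.confidence (k + 1) (Nat.le_add_left 1 k))
  filter_upwards [ae_eventually_notMem hsum] with w hw
  rw [← map_add_atTop_eq_nat 1, eventually_map]
  filter_upwards [hw] with k hk using not_not.1 hk

end Model

/-! ### Tail integrands -/

/-- Common form of the integrands of the leader and of the follower. -/
def tail (s : ℝ → ℝ) (β : ℝ) (e : (Fin n → ℝ) × ℝ) (c : Fin n → ℝ) : ℝ :=
  e.2 + β * s (c ⬝ᵥ e.1 - e.2)

/-- Expected tail integrand. -/
noncomputable def tailMean (s : ℝ → ℝ) (β : ℝ) (Q : Measure (Fin n → ℝ)) (e : (Fin n → ℝ) × ℝ) : ℝ :=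
  ∫ c, tail s β e c ∂Q

theorem continuous_dotProduct_left (y : Fin n → ℝ) : Continuous fun c : Fin n → ℝ => c ⬝ᵥ y :=
  Continuous.dotProduct continuous_id continuous_const

/-- The function `s` is nonexpansive and vanishes at `0`. -/
structure IsTail (s : ℝ → ℝ) : Prop where
  abs_sub_le : ∀ a b, |s a - s b| ≤ |a - b|
  zero : s 0 = 0

theorem isTail_min : IsTail fun x => min x 0 where
  abs_sub_le a b := (abs_min_sub_min_le_max a 0 b 0).trans (by simp)
  zero := by simp

theorem isTail_max : IsTail fun x => max x 0 where
  abs_sub_le a b := (abs_max_sub_max_le_max a 0 b 0).trans (by simp)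
  zero := by simp

namespace IsTail

variable {s : ℝ → ℝ} (hs : IsTail s) {β : ℝ} (hβ : 0 ≤ β)

include hs

theorem continuous : Continuous s := by
  refine (LipschitzWith.of_dist_le_mul (K := 1) fun a b => ?_).continuous
  simpa [Real.dist_eq] using hs.abs_sub_le a b

theorem continuous_tail (e : (Fin n → ℝ) × ℝ) : Continuous (tail s β e) :=
  continuous_const.add (continuous_const.mul
    (hs.continuous.comp ((continuous_dotProduct_left e.1).sub continuous_const)))

include hβ

/-- The shift by `e.2` cancels in the difference, so the constant depends on `e.1` alone. -/
theorem abs_tail_sub_tail_le (e : (Fin n → ℝ) × ℝ) (c c' : Fin n → ℝ) :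
    |tail s β e c - tail s β e c'| ≤ β * n * ‖e.1‖ * ‖c - c'‖ := by
  have h1 := hs.abs_sub_le (c ⬝ᵥ e.1 - e.2) (c' ⬝ᵥ e.1 - e.2)
  rw [sub_sub_sub_cancel_right, ← sub_dotProduct] at h1
  have h2 := h1.trans (abs_dotProduct_le_norm (c - c') e.1)
  rw [tail, tail, add_sub_add_left_eq_sub, ← mul_sub, abs_mul, abs_of_nonneg hβ]
  calc _ ≤ β * (n * ‖c - c'‖ * ‖e.1‖) := mul_le_mul_of_nonneg_left h2 hβ
    _ = _ := by ring

theorem abs_tail_sub_tail_le' {R : ℝ} {c : Fin n → ℝ} (hc : ‖c‖ ≤ R) (e e' : (Fin n → ℝ) × ℝ) :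
    |tail s β e c - tail s β e' c| ≤ (1 + β * (n * R + 1)) * ‖e - e'‖ := by
  have h1 := hs.abs_sub_le (c ⬝ᵥ e.1 - e.2) (c ⬝ᵥ e'.1 - e'.2)
  have hR : 0 ≤ R := (norm_nonneg c).trans hc
  have e1 : ‖e.1 - e'.1‖ ≤ ‖e - e'‖ := norm_fst_le (e - e')
  have e2 : |e.2 - e'.2| ≤ ‖e - e'‖ := norm_snd_le (e - e')
  have h2 : |c ⬝ᵥ (e.1 - e'.1)| ≤ n * R * ‖e - e'‖ :=
    (abs_dotProduct_le_norm _ _).trans (by gcongr)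
  have h3 : |(c ⬝ᵥ e.1 - e.2) - (c ⬝ᵥ e'.1 - e'.2)| ≤ (n * R + 1) * ‖e - e'‖ := by
    have : (c ⬝ᵥ e.1 - e.2) - (c ⬝ᵥ e'.1 - e'.2) = c ⬝ᵥ (e.1 - e'.1) - (e.2 - e'.2) := by
      rw [dotProduct_sub]; ring
    rw [this]
    exact (abs_sub _ _).trans (by linarith)
  have h4 := mul_le_mul_of_nonneg_left (h1.trans h3) hβ
  have : tail s β e c - tail s β e' c =
      (e.2 - e'.2) + β * (s (c ⬝ᵥ e.1 - e.2) - s (c ⬝ᵥ e'.1 - e'.2)) := by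
    simp only [tail]; ring
  rw [this]
  refine (abs_add_le _ _).trans ?_
  rw [abs_mul, abs_of_nonneg hβ]
  linarith

end IsTail

/-! ### Regular risks -/

namespace Model

variable (M : Model m n mX mY mS)

/-- A risk functional that is Lipschitz in the decision, vanishes at the zero decision, and varies
little over Wasserstein balls. -/
structure IsRegularRisk {E : Type*} [NormedAddCommGroup E] (v : Measure (Fin n → ℝ) → E → ℝ)
    (C : ℝ) : Prop where
  nonneg : 0 ≤ C
  lip : ∀ Q ∈ distributions M.S, ∀ e e', |v Q e - v Q e'| ≤ C * ‖e - e'‖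
  zero : ∀ Q ∈ distributions M.S, v Q 0 = 0
  close : ∀ {eps : ℝ} {w : ℕ → Fin n → ℝ} {k : ℕ} {Q Q' : Measure (Fin n → ℝ)},
    (∀ i, w i ∈ M.S) → 1 ≤ k → 0 ≤ eps → Q ∈ M.ambiguitySet eps w k →
    Q' ∈ M.ambiguitySet eps w k → ∀ e, |v Q e - v Q' e| ≤ C * ‖e‖ * eps

variable {M}

/-! ### Robust versions of regular risks -/

namespace IsRegularRisk

variable {E : Type*} [NormedAddCommGroup E] {v : Measure (Fin n → ℝ) → E → ℝ} {C : ℝ}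
  (hv : M.IsRegularRisk v C)

include hv

theorem abs_le {Q : Measure (Fin n → ℝ)} (hQ : Q ∈ distributions M.S) (e : E) :
    |v Q e| ≤ C * ‖e‖ := by
  simpa [hv.zero Q hQ] using hv.lip Q hQ e 0

theorem lipschitzWith {Q : Measure (Fin n → ℝ)} (hQ : Q ∈ distributions M.S) :
    LipschitzWith C.toNNReal (v Q) :=
  LipschitzWith.of_dist_le_mul fun e e' => by
    rw [Real.dist_eq, dist_eq_norm, Real.coe_toNNReal _ hv.nonneg]
    exact hv.lip Q hQ e e'

variable {A : Set (Measure (Fin n → ℝ))} (hA : A ⊆ distributions M.S) (hne : A.Nonempty)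

include hA

theorem bddBelow (e : E) : BddBelow ((fun Q => v Q e) '' A) :=
  ⟨-(C * ‖e‖), by rintro _ ⟨Q, hQ, rfl⟩; exact (_root_.abs_le.1 (hv.abs_le (hA hQ) e)).1⟩

theorem bddAbove (e : E) : BddAbove ((fun Q => v Q e) '' A) :=
  ⟨C * ‖e‖, by rintro _ ⟨Q, hQ, rfl⟩; exact (_root_.abs_le.1 (hv.abs_le (hA hQ) e)).2⟩

include hne

theorem continuous_sInf : Continuous fun e => sInf ((fun Q => v Q e) '' A) :=
  (LipschitzWith.of_dist_le_mul (K := C.toNNReal) fun e e' => by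
    rw [Real.dist_eq, dist_eq_norm, Real.coe_toNNReal _ hv.nonneg]
    exact abs_sInf_image_sub_le hne (hv.bddBelow hA e) (hv.bddBelow hA e')
      fun Q hQ => hv.lip Q (hA hQ) e e').continuous

theorem continuous_sSup : Continuous fun e => sSup ((fun Q => v Q e) '' A) :=
  (LipschitzWith.of_dist_le_mul (K := C.toNNReal) fun e e' => by
    rw [Real.dist_eq, dist_eq_norm, Real.coe_toNNReal _ hv.nonneg]
    exact abs_sSup_image_sub_le hne (hv.bddAbove hA e) (hv.bddAbove hA e')
      fun Q hQ => hv.lip Q (hA hQ) e e').continuous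

end IsRegularRisk

section

variable {E : Type*} [NormedAddCommGroup E] {v : Measure (Fin n → ℝ) → E → ℝ} {C : ℝ}
  (hv : M.IsRegularRisk v C) {w : ℕ → Fin n → ℝ} (hw : ∀ i, w i ∈ M.S)
  {Q : Measure (Fin n → ℝ)} {eps : ℕ → ℝ} (heps : ∀ k, 1 ≤ k → 0 ≤ eps k)
  (hlim : Tendsto eps atTop (𝓝 0)) (hQ : ∀ᶠ k in atTop, Q ∈ M.ambiguitySet (eps k) w k)
  {D : Set E} (hD : Bornology.IsBounded D)

include hv hw heps hlim hQ hD

theorem IsRegularRisk.eventually_forall_close {e : ℝ} (he : 0 < e) :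
    ∀ᶠ k in atTop, Q ∈ M.ambiguitySet (eps k) w k ∧
      ∀ Q' ∈ M.ambiguitySet (eps k) w k, ∀ a ∈ D, |v Q' a - v Q a| ≤ e := by
  obtain ⟨R, hR0, hR⟩ := hD.exists_pos_norm_le
  have h1 : Tendsto (fun k => C * R * eps k) atTop (𝓝 0) := by simpa using hlim.const_mul (C * R)
  filter_upwards [hQ, eventually_ge_atTop 1, h1.eventually (ge_mem_nhds he)] with k hk hk1 hke
  refine ⟨hk, fun Q' hQ' a ha => (hv.close hw hk1 (heps k hk1) hQ' hk a).trans (le_trans ?_ hke)⟩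
  exact mul_le_mul_of_nonneg_right (mul_le_mul_of_nonneg_left (hR a ha) hv.nonneg) (heps k hk1)

theorem IsRegularRisk.eventually_sInf_close {e : ℝ} (he : 0 < e) :
    ∀ᶠ k in atTop, ∀ a ∈ D, |sInf ((fun Q' => v Q' a) '' M.ambiguitySet (eps k) w k) - v Q a| ≤ e := by
  filter_upwards [hv.eventually_forall_close hw heps hlim hQ hD he] with k hk a ha
  have hne : (M.ambiguitySet (eps k) w k).Nonempty := ⟨Q, hk.1⟩
  -- The true value is written as the infimum of a constant family over the same non-empty ball.
  have := abs_sInf_image_sub_le (g' := fun _ => v Q a) hne (hv.bddBelow (fun _ h => h.1) a)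
    (by rw [hne.image_const]; exact bddBelow_singleton) fun Q' hQ' => hk.2 Q' hQ' a ha
  rwa [hne.image_const, csInf_singleton] at this

theorem IsRegularRisk.eventually_sSup_close {e : ℝ} (he : 0 < e) :
    ∀ᶠ k in atTop, ∀ a ∈ D, |sSup ((fun Q' => v Q' a) '' M.ambiguitySet (eps k) w k) - v Q a| ≤ e := by
  filter_upwards [hv.eventually_forall_close hw heps hlim hQ hD he] with k hk a ha
  have hne : (M.ambiguitySet (eps k) w k).Nonempty := ⟨Q, hk.1⟩
  have := abs_sSup_image_sub_le (g' := fun _ => v Q a) hne (hv.bddAbove (fun _ h => h.1) a)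
    (by rw [hne.image_const]; exact bddAbove_singleton) fun Q' hQ' => hk.2 Q' hQ' a ha
  rwa [hne.image_const, csSup_singleton] at this

end

/-! ### The four risks are regular -/

section

variable (hp : 1 ≤ M.p) (hSc : IsCompact M.S) {s : ℝ → ℝ} (hs : IsTail s) {β : ℝ} (hβ : 1 ≤ β)
  {R : ℝ} (hR0 : 0 ≤ R) (hR : ∀ c ∈ M.S, ‖c‖ ≤ R)

include hSc hs

theorem abs_tailMean_sub_le {Q : Measure (Fin n → ℝ)} (hQ : Q ∈ distributions M.S) (hβ : 1 ≤ β)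
    (hR : ∀ c ∈ M.S, ‖c‖ ≤ R) (e e' : (Fin n → ℝ) × ℝ) :
    |tailMean s β Q e - tailMean s β Q e'| ≤ (1 + β * (n * R + 1)) * ‖e - e'‖ := by
  have := hQ.1
  rw [tailMean, tailMean, ← integral_sub
    (integrable_of_mem_distributions hSc hQ (hs.continuous_tail e))
    (integrable_of_mem_distributions hSc hQ (hs.continuous_tail e')), ← Real.norm_eq_abs]
  refine (norm_integral_le_of_norm_le_const (C := (1 + β * (n * R + 1)) * ‖e - e'‖) ?_).trans
    (by simp)
  filter_upwards [ae_mem_of_mem_distributions hQ] with c hc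
  exact hs.abs_tail_sub_tail_le' (by linarith) (hR c hc) e e'

include hp

/-- The bound involves `‖e.1‖` rather than `‖e‖`, so it is uniform in `t` and survives the extremum
over all real `t`. -/
theorem abs_tailMean_sub_tailMean_le (hβ : 1 ≤ β) {eps : ℝ} {w : ℕ → Fin n → ℝ} {k : ℕ}
    {Q Q' : Measure (Fin n → ℝ)} (hw : ∀ i, w i ∈ M.S) (hk : 1 ≤ k) (heps : 0 ≤ eps)
    (hQ : Q ∈ M.ambiguitySet eps w k) (hQ' : Q' ∈ M.ambiguitySet eps w k) (e : (Fin n → ℝ) × ℝ) :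
    |tailMean s β Q e - tailMean s β Q' e| ≤ 2 * β * n * ‖e.1‖ * eps := by
  refine (abs_integral_sub_le_of_mem_ambiguitySet hp hSc hw hk heps hQ hQ'
    (K := β * n * ‖e.1‖) (by positivity) (hs.continuous_tail e)
    (hs.abs_tail_sub_tail_le (by linarith) e)).trans (le_of_eq (by ring))

include hβ hR0 hR

/-- The constant adds the Lipschitz constant in the decision to the one for closeness over a ball.
-/
theorem isRegularRisk_tailMean :
    M.IsRegularRisk (tailMean s β) (1 + β * (n * R + 1) + 2 * β * n) where
  nonneg := by positivity
  lip Q hQ e e' := (abs_tailMean_sub_le hSc hs hQ hβ hR e e').trans (by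
    have : 0 ≤ 2 * β * n * ‖e - e'‖ := by positivity
    linarith)
  zero Q hQ := by simp [tailMean, tail, hs.zero]
  close {eps w k Q Q'} hw hk heps hQ hQ' e := by
    refine (abs_tailMean_sub_tailMean_le hp hSc hs hβ hw hk heps hQ hQ' e).trans ?_
    have h1 : ‖e.1‖ ≤ ‖e‖ := norm_fst_le e
    have h2 : 2 * β * n * ‖e.1‖ ≤ 2 * β * n * ‖e‖ := by gcongr
    have h3 : 0 ≤ (1 + β * (n * R + 1)) * ‖e‖ := by positivity
    exact mul_le_mul_of_nonneg_right (by linarith) heps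

end

section

variable (hp : 1 ≤ M.p) (hSc : IsCompact M.S) {β : ℝ} (hβ : 1 ≤ β)
  {R : ℝ} (hR0 : 0 ≤ R) (hR : ∀ c ∈ M.S, ‖c‖ ≤ R)

include hSc hβ

/-- Since `β ≥ 1`, the integrand is at most `t + min (c ⬝ᵥ y - t) 0 ≤ c ⬝ᵥ y`, whatever `t` is. -/
theorem bddAbove_tailMean_min {Q : Measure (Fin n → ℝ)} (hQ : Q ∈ distributions M.S)
    (y : Fin n → ℝ) :
    BddAbove ((fun t => tailMean (fun x => min x 0) β Q (y, t)) '' univ) := by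
  refine ⟨∫ c, c ⬝ᵥ y ∂Q, ?_⟩
  rintro _ ⟨t, -, rfl⟩
  refine integral_mono (integrable_of_mem_distributions hSc hQ (isTail_min.continuous_tail _))
    (integrable_of_mem_distributions hSc hQ (continuous_dotProduct_left y)) fun c => ?_
  have h1 : β * min (c ⬝ᵥ y - t) 0 ≤ 1 * min (c ⬝ᵥ y - t) 0 :=
    mul_le_mul_of_nonpos_right hβ (min_le_right _ _)
  simp only [tail]
  linarith [min_le_left (c ⬝ᵥ y - t) 0]

theorem bddBelow_tailMean_max {Q : Measure (Fin n → ℝ)} (hQ : Q ∈ distributions M.S)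
    (y : Fin n → ℝ) :
    BddBelow ((fun t => tailMean (fun x => max x 0) β Q (y, t)) '' univ) := by
  refine ⟨∫ c, c ⬝ᵥ y ∂Q, ?_⟩
  rintro _ ⟨t, -, rfl⟩
  refine integral_mono (integrable_of_mem_distributions hSc hQ (continuous_dotProduct_left y))
    (integrable_of_mem_distributions hSc hQ (isTail_max.continuous_tail _)) fun c => ?_
  have h1 : 1 * max (c ⬝ᵥ y - t) 0 ≤ β * max (c ⬝ᵥ y - t) 0 :=
    mul_le_mul_of_nonneg_right hβ (le_max_right _ _)
  simp only [tail]
  linarith [le_max_left (c ⬝ᵥ y - t) 0]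

include hp hR0 hR

theorem isRegularRisk_sSup_tailMean :
    M.IsRegularRisk (fun Q y => sSup ((fun t => tailMean (fun x => min x 0) β Q (y, t)) '' univ))
      (1 + β * (n * R + 1) + 2 * β * n) where
  nonneg := by positivity
  lip Q hQ y y' := abs_sSup_image_sub_le univ_nonempty (bddAbove_tailMean_min hSc hβ hQ y)
    (bddAbove_tailMean_min hSc hβ hQ y') fun t _ => by
      have := (isRegularRisk_tailMean hp hSc isTail_min hβ hR0 hR).lip Q hQ (y, t) (y', t)
      simpa using this
  zero Q hQ := by
    have := hQ.1
    have hle : ∀ t : ℝ, t + β * min (-t) 0 ≤ 0 := fun t => by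
      have h1 : β * min (-t) 0 ≤ 1 * min (-t) 0 := mul_le_mul_of_nonpos_right hβ (min_le_right _ _)
      linarith [min_le_left (-t) 0]
    have : (fun t => tailMean (fun x => min x 0) β Q ((0 : Fin n → ℝ), t)) =
        fun t => t + β * min (-t) 0 := by
      ext t; simp [tailMean, tail]
    rw [this]
    refine IsGreatest.csSup_eq ⟨⟨0, mem_univ _, by simp⟩, ?_⟩
    rintro _ ⟨t, -, rfl⟩
    exact hle t
  close {eps w k Q Q'} hw hk heps hQ hQ' y := by
    refine abs_sSup_image_sub_le univ_nonempty (bddAbove_tailMean_min hSc hβ hQ.1 y)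
      (bddAbove_tailMean_min hSc hβ hQ'.1 y) fun t _ =>
      (abs_tailMean_sub_tailMean_le hp hSc isTail_min hβ hw hk heps hQ hQ' (y, t)).trans ?_
    have h3 : 0 ≤ (1 + β * (n * R + 1)) * ‖y‖ := by positivity
    exact mul_le_mul_of_nonneg_right (by linarith) heps

theorem isRegularRisk_sInf_tailMean :
    M.IsRegularRisk (fun Q y => sInf ((fun t => tailMean (fun x => max x 0) β Q (y, t)) '' univ))
      (1 + β * (n * R + 1) + 2 * β * n) where
  nonneg := by positivity
  lip Q hQ y y' := abs_sInf_image_sub_le univ_nonempty (bddBelow_tailMean_max hSc hβ hQ y)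
    (bddBelow_tailMean_max hSc hβ hQ y') fun t _ => by
      have := (isRegularRisk_tailMean hp hSc isTail_max hβ hR0 hR).lip Q hQ (y, t) (y', t)
      simpa using this
  zero Q hQ := by
    have := hQ.1
    have hle : ∀ t : ℝ, 0 ≤ t + β * max (-t) 0 := fun t => by
      have h1 : 1 * max (-t) 0 ≤ β * max (-t) 0 := mul_le_mul_of_nonneg_right hβ (le_max_right _ _)
      linarith [le_max_left (-t) 0]
    have : (fun t => tailMean (fun x => max x 0) β Q ((0 : Fin n → ℝ), t)) =
        fun t => t + β * max (-t) 0 := by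
      ext t; simp [tailMean, tail]
    rw [this]
    refine IsLeast.csInf_eq ⟨⟨0, mem_univ _, by simp⟩, ?_⟩
    rintro _ ⟨t, -, rfl⟩
    exact hle t
  close {eps w k Q Q'} hw hk heps hQ hQ' y := by
    refine abs_sInf_image_sub_le univ_nonempty (bddBelow_tailMean_max hSc hβ hQ.1 y)
      (bddBelow_tailMean_max hSc hβ hQ'.1 y) fun t _ =>
      (abs_tailMean_sub_tailMean_le hp hSc isTail_max hβ hw hk heps hQ hQ' (y, t)).trans ?_
    have h3 : 0 ≤ (1 + β * (n * R + 1)) * ‖y‖ := by positivity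
    exact mul_le_mul_of_nonneg_right (by linarith) heps

end

theorem tailMean_eq (hSc : IsCompact M.S) {s : ℝ → ℝ} (hs : IsTail s) (β : ℝ)
    {Q : Measure (Fin n → ℝ)} (hQ : Q ∈ distributions M.S) (y : Fin n → ℝ) (t : ℝ) :
    tailMean s β Q (y, t) = t + β * ∫ c, s (c ⬝ᵥ y - t) ∂Q := by
  have := hQ.1
  have hi : Integrable (fun c => β * s (c ⬝ᵥ y - t)) Q := integrable_of_mem_distributions hSc hQ
    (continuous_const.mul (hs.continuous.comp ((continuous_dotProduct_left y).sub continuous_const)))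
  rw [← integral_const_mul]
  simp only [tailMean, tail]
  rw [integral_add (integrable_const t) hi]
  simp

theorem rhoF_eq (hSc : IsCompact M.S) {alpha : ℝ} (hβ : 1 ≤ 1 / (1 - alpha))
    {Q : Measure (Fin n → ℝ)} (hQ : Q ∈ distributions M.S) (y : Fin n → ℝ) :
    rhoF alpha y Q = ((sSup ((fun t => tailMean (fun x => min x 0) (1 / (1 - alpha)) Q (y, t)) ''
      univ) : ℝ) : EReal) := by
  rw [← biSup_coe_eq univ_nonempty (bddAbove_tailMean_min hSc hβ hQ y)]
  simp only [mem_univ, iSup_pos, rhoF, tailMean_eq hSc isTail_min _ hQ]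

theorem rhoL_eq (hSc : IsCompact M.S) {alpha : ℝ} (hβ : 1 ≤ 1 / (1 - alpha))
    {Q : Measure (Fin n → ℝ)} (hQ : Q ∈ distributions M.S) (y : Fin n → ℝ) :
    rhoL alpha y Q = ((sInf ((fun t => tailMean (fun x => max x 0) (1 / (1 - alpha)) Q (y, t)) ''
      univ) : ℝ) : EReal) := by
  rw [← biInf_coe_eq univ_nonempty (bddBelow_tailMean_max hSc hβ hQ y)]
  simp only [mem_univ, iInf_pos, rhoL, tailMean_eq hSc isTail_max _ hQ]

end Model

namespace Model

variable {M : Model m n mX mY mS}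

/-! ### Convergence of the robust bilevel problem -/

/-- `P` is what the leader's problem appends to the follower's solution set, namely the factor `T`
or nothing; `π` keeps the variables on which the leader's objective depends. -/
theorem bilevel_stability {EF EL γ : Type*} [NormedAddCommGroup EF] [NormedAddCommGroup EL]
    [MetricSpace γ] (hp : 1 ≤ M.p) (hSc : IsCompact M.S)
    {vF : Measure (Fin n → ℝ) → EF → ℝ} {vL : Measure (Fin n → ℝ) → EL → ℝ} {CF CL : ℝ}
    (hvF : M.IsRegularRisk vF CF) (hvL : M.IsRegularRisk vL CL)
    {Q : Measure (Fin n → ℝ)} (hQ : Q ∈ distributions M.S)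
    {epsL epsF : ℕ → ℝ} (hepsL : ∀ k, 1 ≤ k → 0 ≤ epsL k) (hepsF : ∀ k, 1 ≤ k → 0 ≤ epsF k)
    (hlimL : Tendsto epsL atTop (𝓝 0)) (hlimF : Tendsto epsF atTop (𝓝 0))
    {w : ℕ → Fin n → ℝ} (hw : ∀ i, w i ∈ M.S)
    (hQL : ∀ᶠ k in atTop, Q ∈ M.ambiguitySet (epsL k) w k)
    (hQF : ∀ᶠ k in atTop, Q ∈ M.ambiguitySet (epsF k) w k)
    (hX : M.X.Finite) (hXne : M.X.Nonempty) {K : (Fin m → ℝ) → Set EF}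
    (hK : ∀ x ∈ M.X, IsCompact (K x)) (hKne : ∀ x ∈ M.X, (K x).Nonempty)
    (huniq : ∀ x ∈ M.X, ∃! a, a ∈ argmaxOn (fun a => (vF Q a : EReal)) (K x))
    {P : Set EF → Set γ} (hPmono : Monotone P) (hPc : ∀ V, IsCompact V → IsCompact (P V))
    (hP : ∀ Vs V, IsStableLimit Vs V → IsStableLimit (P Vs) fun k => P (V k))
    {π : γ → EL} (hπ : UniformContinuous π)
    {Fs : Set ((Fin m → ℝ) × γ)} {F : ℕ → Set ((Fin m → ℝ) × γ)}
    {Ψs : (Fin m → ℝ) × γ → EReal} {Ψ : ℕ → (Fin m → ℝ) × γ → EReal}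
    (hFs : Fs = bilevelPairs M.X fun x => P (argmaxOn (fun a => (vF Q a : EReal)) (K x)))
    (hF : ∀ k, F k = bilevelPairs M.X fun x =>
      P (argmaxOn (fun a => ⨅ Q ∈ M.ambiguitySet (epsF k) w k, (vF Q a : EReal)) (K x)))
    (hΨs : ∀ z, Ψs z = vL Q (π z.2))
    (hΨ : ∀ k z, Ψ k z = ⨆ Q ∈ M.ambiguitySet (epsL k) w k, (vL Q (π z.2) : EReal)) :
    (∀ kl kf : ℕ, 1 ≤ kf → kf ≤ kl → (argminOn (Ψ kl) (F kf)).Nonempty) ∧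
    limsup (fun kf : ℕ => limsup (fun kl : ℕ => minValue (Ψ kl) (F kf)) atTop) atTop =
      minValue Ψs Fs ∧
    (∀ u : ℕ → ℕ → (Fin m → ℝ) × γ,
      (∀ kl kf : ℕ, 1 ≤ kf → kf ≤ kl → u kl kf ∈ argminOn (Ψ kl) (F kf)) →
      ∀ a, IsAccumulationPoint a u → a ∈ argminOn Ψs Fs) := by
  have hsub : ∀ (eps : ℝ) k, M.ambiguitySet eps w k ⊆ distributions M.S := fun _ _ _ h => h.1
  have hne : ∀ (eps : ℝ) k, 1 ≤ k → (M.ambiguitySet eps w k).Nonempty := fun eps k hk =>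
    ⟨_, empirical_mem_ambiguitySet hp hSc hw hk eps⟩
  have hD : Bornology.IsBounded (⋃ x ∈ M.X, π '' P (K x)) :=
    (Bornology.isBounded_biUnion hX).2 fun x hx =>
      ((hPc _ (hK x hx)).image hπ.continuous).isBounded
  obtain rfl : F = _ := funext hF
  subst hFs
  refine minimization_stability (D := bilevelPairs M.X fun x => P (K x))
    (fs := fun z => vL Q (π z.2))
    (f := fun k z => sSup ((fun Q' => vL Q' (π z.2)) '' M.ambiguitySet (epsL k) w k))
    hΨs (fun k hk z => ?_) (isStableLimit_bilevelPairs hX hXne fun x hx => hP _ _ ?_)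
    (fun k hk z hz => ⟨hz.1, hPmono (fun _ h => h.1) hz.2⟩) ?_ (fun k hk => ?_) (fun e he => ?_)
  · rw [hΨ, biSup_coe_eq (hne _ k hk) (hvL.bddAbove (hsub _ k) _)]
  · exact isStableLimit_argmaxOn (hK x hx) (hKne x hx) (hvF.lipschitzWith hQ).continuous
      (fun k hk => hvF.continuous_sInf (hsub (epsF k) k) (hne _ k hk))
      (fun e he => hvF.eventually_sInf_close hw hepsF hlimF hQF (hK x hx).isBounded he)
      (fun _ => rfl) (fun k hk a => biInf_coe_eq (hne _ k hk) (hvF.bddBelow (hsub _ k) a))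
      (huniq x hx)
  · exact (hvL.lipschitzWith hQ).uniformContinuous.comp (hπ.comp uniformContinuous_snd)
  · exact (hvL.continuous_sSup (hsub _ k) (hne _ k hk)).comp (hπ.continuous.comp continuous_snd)
  · filter_upwards [hvL.eventually_sSup_close hw hepsL hlimL hQL hD he] with k hk z hz
    exact hk _ (mem_biUnion hz.1 ⟨z.2, hz.2, rfl⟩)

/-! ### Feasible sets -/

variable (M) in
theorem finite_X : M.X.Finite :=
  (Set.Finite.pi' fun _ : Fin m => ({0, 1} : Set ℝ).toFinite).subset fun _ hx i => hx.1 i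

theorem isCompact_Y {x : Fin m → ℝ} (h : Bornology.IsBounded (M.Y x)) : IsCompact (M.Y x) := by
  refine Metric.isCompact_of_isClosed_isBounded (IsClosed.inter ?_ ?_) h
  · exact isClosed_le continuous_const continuous_id
  · exact isClosed_le ((Continuous.matrix_mulVec continuous_const continuous_id).add
      continuous_const) continuous_const

theorem isBounded_profits (hY : ∀ x ∈ M.X, Bornology.IsBounded (M.Y x)) (hSc : IsCompact M.S) :
    Bornology.IsBounded M.profits := by
  have hsub : M.profits ⊆ ⋃ x ∈ M.X, (fun z : (Fin n → ℝ) × (Fin n → ℝ) => z.1 ⬝ᵥ z.2) ''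
      (M.S ×ˢ M.Y x) := by
    rintro r ⟨x, hx, c, hc, y, hy, rfl⟩
    exact mem_biUnion hx ⟨(c, y), ⟨hc, hy⟩, rfl⟩
  refine Bornology.IsBounded.subset ((Bornology.isBounded_biUnion M.finite_X).2 fun x hx => ?_) hsub
  exact ((hSc.prod (isCompact_Y (hY x hx))).image
    (Continuous.dotProduct continuous_fst continuous_snd)).isBounded

theorem tRange_nonempty (hX : M.X.Nonempty)
    (hY : ∀ x ∈ M.X, (M.Y x).Nonempty ∧ Bornology.IsBounded (M.Y x))
    (hS : M.S.Nonempty) (hSc : IsCompact M.S) : M.tRange.Nonempty := by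
  obtain ⟨x, hx⟩ := hX
  obtain ⟨y, hy⟩ := (hY x hx).1
  obtain ⟨c, hc⟩ := hS
  have hb := isBounded_profits (fun x hx => (hY x hx).2) hSc
  exact nonempty_Icc.2 (csInf_le_csSup (s := M.profits) ⟨_, x, hx, c, hc, y, hy, rfl⟩ hb.bddBelow hb.bddAbove)

theorem dotProduct_mem_tRange (hY : ∀ x ∈ M.X, Bornology.IsBounded (M.Y x))
    (hSc : IsCompact M.S) {x : Fin m → ℝ} (hx : x ∈ M.X) {y : Fin n → ℝ} (hy : y ∈ M.Y x)
    {c : Fin n → ℝ} (hc : c ∈ M.S) : c ⬝ᵥ y ∈ M.tRange := by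
  have hb := isBounded_profits hY hSc
  exact ⟨csInf_le hb.bddBelow ⟨x, hx, c, hc, y, hy, rfl⟩,
    le_csSup hb.bddAbove ⟨x, hx, c, hc, y, hy, rfl⟩⟩

/-! ### Attainment of the auxiliary variables -/

/-- As a function of `t` the left side has slope `1` before `v` and `1 - β ≤ 0` after it, so moving
`t` to the nearest point of an interval containing `v` cannot decrease it. -/
theorem add_mul_min_le_clamp {β a b v : ℝ} (hβ : 1 ≤ β) (hv : v ∈ Icc a b) (t : ℝ) :
    t + β * min (v - t) 0 ≤ max a (min b t) + β * min (v - max a (min b t)) 0 := by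
  obtain ⟨h1, h2⟩ := hv
  rcases le_total t a with h | h
  · rw [min_eq_right (h.trans (h1.trans h2)), max_eq_left h, min_eq_right (by linarith),
      min_eq_right (by linarith)]
    linarith
  · rcases le_total t b with h' | h'
    · rw [min_eq_right h', max_eq_right h]
    · rw [min_eq_left h', max_eq_right (h1.trans h2), min_eq_left (by linarith),
        min_eq_left (by linarith)]
      nlinarith

theorem clamp_add_mul_max_le {β a b v : ℝ} (hβ : 1 ≤ β) (hv : v ∈ Icc a b) (t : ℝ) :
    max a (min b t) + β * max (v - max a (min b t)) 0 ≤ t + β * max (v - t) 0 := by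
  obtain ⟨h1, h2⟩ := hv
  rcases le_total t a with h | h
  · rw [min_eq_right (h.trans (h1.trans h2)), max_eq_left h, max_eq_left (by linarith),
      max_eq_left (by linarith)]
    nlinarith
  · rcases le_total t b with h' | h'
    · rw [min_eq_right h', max_eq_right h]
    · rw [min_eq_left h', max_eq_right (h1.trans h2), max_eq_right (by linarith),
        max_eq_right (by linarith)]
      linarith

section

variable (hY : ∀ x ∈ M.X, Bornology.IsBounded (M.Y x)) (hSc : IsCompact M.S)
  (hT : M.tRange.Nonempty) {β : ℝ} (hβ : 1 ≤ β) {Q : Measure (Fin n → ℝ)}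
  (hQ : Q ∈ distributions M.S) {x : Fin m → ℝ} (hx : x ∈ M.X) {y : Fin n → ℝ} (hy : y ∈ M.Y x)

include hSc hQ in
theorem continuous_tailMean {s : ℝ → ℝ} (hs : IsTail s) (hβ : 1 ≤ β) : Continuous (tailMean s β Q) := by
  obtain ⟨R, -, hR⟩ := hSc.isBounded.exists_pos_norm_le
  refine (LipschitzWith.of_dist_le_mul (K := (1 + β * (n * R + 1)).toNNReal) fun e e' => ?_).continuous
  rw [Real.dist_eq, dist_eq_norm]
  exact (abs_tailMean_sub_le hSc hs hQ hβ hR e e').trans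
    (mul_le_mul_of_nonneg_right (Real.le_coe_toNNReal _) (norm_nonneg _))

include hY hSc hT hβ hQ hx hy

theorem exists_tailMean_min_eq_sSup : ∃ t ∈ M.tRange,
    sSup ((fun t => tailMean (fun x => min x 0) β Q (y, t)) '' univ) =
      tailMean (fun x => min x 0) β Q (y, t) := by
  obtain ⟨t, ht, hmax⟩ := isCompact_Icc.exists_isMaxOn (f := fun t => tailMean (fun x => min x 0) β Q (y, t))
    hT ((continuous_tailMean hSc hQ isTail_min hβ).comp (Continuous.prodMk_right y)).continuousOn
  refine ⟨t, ht, IsGreatest.csSup_eq ⟨⟨t, mem_univ _, rfl⟩, ?_⟩⟩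
  rintro _ ⟨r, -, rfl⟩
  -- Clamping `r` to `T` improves the integrand for every scenario in `S`, hence in the mean.
  refine le_trans ?_ (hmax ⟨le_max_left (sInf M.profits) (min (sSup M.profits) r),
    max_le (nonempty_Icc.1 hT) (min_le_left _ _)⟩)
  refine integral_mono_ae (integrable_of_mem_distributions hSc hQ (isTail_min.continuous_tail _))
    (integrable_of_mem_distributions hSc hQ (isTail_min.continuous_tail _)) ?_
  filter_upwards [ae_mem_of_mem_distributions hQ] with c hc
  exact add_mul_min_le_clamp hβ (dotProduct_mem_tRange hY hSc hx hy hc) r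

theorem exists_tailMean_max_eq_sInf : ∃ t ∈ M.tRange,
    sInf ((fun t => tailMean (fun x => max x 0) β Q (y, t)) '' univ) =
      tailMean (fun x => max x 0) β Q (y, t) := by
  obtain ⟨t, ht, hmin⟩ := isCompact_Icc.exists_isMinOn (f := fun t => tailMean (fun x => max x 0) β Q (y, t))
    hT ((continuous_tailMean hSc hQ isTail_max hβ).comp (Continuous.prodMk_right y)).continuousOn
  refine ⟨t, ht, IsLeast.csInf_eq ⟨⟨t, mem_univ _, rfl⟩, ?_⟩⟩
  rintro _ ⟨r, -, rfl⟩
  refine le_trans (hmin ⟨le_max_left (sInf M.profits) (min (sSup M.profits) r),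
    max_le (nonempty_Icc.1 hT) (min_le_left _ _)⟩) ?_
  refine integral_mono_ae (integrable_of_mem_distributions hSc hQ (isTail_max.continuous_tail _))
    (integrable_of_mem_distributions hSc hQ (isTail_max.continuous_tail _)) ?_
  filter_upwards [ae_mem_of_mem_distributions hQ] with c hc
  exact clamp_add_mul_max_le hβ (dotProduct_mem_tRange hY hSc hx hy hc) r

end

/-! ### Equivalence of the two full-information formulations -/

/-- A joint maximum over `(y, t)` is an iterated one, because the optimal `t` is attained in `T`.
Uniqueness of the follower's pair thereby passes to `y`. -/
theorem mem_argmaxOn_rhoF_iff (hY : ∀ x ∈ M.X, Bornology.IsBounded (M.Y x)) (hSc : IsCompact M.S)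
    (hT : M.tRange.Nonempty) (hβ : 1 ≤ 1 / (1 - M.alphaF)) {Q : Measure (Fin n → ℝ)}
    (hQ : Q ∈ distributions M.S) {x : Fin m → ℝ} (hx : x ∈ M.X) {y : Fin n → ℝ} :
    y ∈ argmaxOn (fun y => rhoF M.alphaF y Q) (M.Y x) ↔ ∃ t, (y, t) ∈ M.VStar Q x := by
  have hle : ∀ e : (Fin n → ℝ) × ℝ,
      tailMean (fun x => min x 0) (1 / (1 - M.alphaF)) Q e ≤
        sSup ((fun t => tailMean (fun x => min x 0) (1 / (1 - M.alphaF)) Q (e.1, t)) '' univ) :=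
    fun e => le_csSup (bddAbove_tailMean_min hSc hβ hQ e.1) ⟨e.2, mem_univ _, rfl⟩
  have hatt := fun {y} (hy : y ∈ M.Y x) => exists_tailMean_min_eq_sSup hY hSc hT hβ hQ hx hy
  constructor
  · rintro ⟨hy, hmax⟩
    obtain ⟨t, ht, hty⟩ := hatt hy
    refine ⟨t, ⟨hy, ht⟩, fun e he => EReal.coe_le_coe_iff.2 ?_⟩
    have h1 := hmax e.1 he.1
    simp only [rhoF_eq hSc hβ hQ, EReal.coe_le_coe_iff] at h1
    exact (hle e).trans (h1.trans hty.le)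
  · rintro ⟨t, ⟨hy, -⟩, hmax⟩
    refine ⟨hy, fun y' hy' => ?_⟩
    obtain ⟨t', ht', hty⟩ := hatt hy'
    simp only [rhoF_eq hSc hβ hQ, EReal.coe_le_coe_iff]
    rw [hty]
    exact (EReal.coe_le_coe_iff.1 (hmax (y', t') ⟨hy', ht'⟩)).trans (hle (y, t))

theorem minValue_objStar_eq (hY : ∀ x ∈ M.X, Bornology.IsBounded (M.Y x)) (hSc : IsCompact M.S)
    (hT : M.tRange.Nonempty) (hβF : 1 ≤ 1 / (1 - M.alphaF)) (hβL : 1 ≤ 1 / (1 - M.alphaL))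
    {Q : Measure (Fin n → ℝ)} (hQ : Q ∈ distributions M.S) :
    minValue (M.objStar Q) (M.Xbar (M.VStar Q)) = minValue (M.objSI Q) (M.feasibleSI Q) := by
  refine le_antisymm (le_iInf₂ fun z hz => ?_) (le_iInf₂ fun xb hxb => ?_)
  · obtain ⟨tf, htf⟩ := (mem_argmaxOn_rhoF_iff hY hSc hT hβF hQ hz.1).1 hz.2
    obtain ⟨tl, htl, h⟩ := exists_tailMean_max_eq_sInf hY hSc hT hβL hQ hz.1 hz.2.1
    refine (iInf₂_le (z.1, (z.2, tf), tl) ⟨hz.1, htf, htl⟩).trans ?_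
    rw [objSI, rhoL_eq hSc hβL hQ, h]
    rfl
  · refine (iInf₂_le (xb.1, xb.2.1.1)
      ⟨hxb.1, (mem_argmaxOn_rhoF_iff hY hSc hT hβF hQ hxb.1).2 ⟨xb.2.1.2, hxb.2.1⟩⟩).trans ?_
    rw [objSI, rhoL_eq hSc hβL hQ]
    exact EReal.coe_le_coe_iff.2
      (csInf_le (bddBelow_tailMean_max hSc hβL hQ _) ⟨xb.2.2, mem_univ _, rfl⟩)

end Model

end DRI

/-! ### The main theorem -/

theorem theorem2 {m n mX mY mS : ℕ} (M : DRI.Model m n mX mY mS)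
    (hp : 1 ≤ M.p)
    (halphaL : M.alphaL ∈ Ioo (0 : ℝ) 1) (halphaF : M.alphaF ∈ Ioo (0 : ℝ) 1)
    -- feasible sets are non-empty and bounded
    (hX : M.X.Nonempty) (hXb : Bornology.IsBounded M.X)
    (hY : ∀ x ∈ M.X, (M.Y x).Nonempty ∧ Bornology.IsBounded (M.Y x))
    -- the support set is non-empty and compact, and carries the true distribution
    (hS : M.S.Nonempty) (hSc : IsCompact M.S)
    (Q : Measure (Fin n → ℝ)) [IsProbabilityMeasure Q] (hQ : Q ∈ DRI.distributions M.S)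
    -- significance levels and Wasserstein radii of the leader and of the follower
    (thetaL epsL thetaF epsF : ℕ → ℝ)
    (hL : M.ValidRadii Q thetaL epsL) (hF : M.ValidRadii Q thetaF epsF)
    -- uniqueness for the follower's full information problem
    (huniq : ∀ x ∈ M.X, ∃! yt, yt ∈ M.VStar Q x) :
    -- the full information problem has an optimal solution, in both formulations,
    -- with the same optimal value
    (DRI.argminOn (M.objStar Q) (M.Xbar (M.VStar Q))).Nonempty ∧
    (DRI.argminOn (M.objSI Q) (M.feasibleSI Q)).Nonempty ∧
    DRI.minValue (M.objStar Q) (M.Xbar (M.VStar Q)) =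
      DRI.minValue (M.objSI Q) (M.feasibleSI Q) ∧
    -- almost surely with respect to the law of the i.i.d. sample sequence `w`, whose first `kl`
    -- (first `kf`) terms are the data set of the leader (of the follower):
    ∀ᵐ w ∂(Measure.infinitePi (fun _ : ℕ => Q)),
      -- the leader's problem with auxiliary variables
      (∀ kl kf : ℕ, 1 ≤ kf → kf ≤ kl →
        (DRI.argminOn (M.objHat (M.ambiguitySet (epsL kl) w kl))
          (M.Xbar (M.VHat (M.ambiguitySet (epsF kf) w kf)))).Nonempty) ∧
      limsup (fun kf : ℕ => limsup (fun kl : ℕ =>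
          DRI.minValue (M.objHat (M.ambiguitySet (epsL kl) w kl))
            (M.Xbar (M.VHat (M.ambiguitySet (epsF kf) w kf)))) atTop) atTop =
        DRI.minValue (M.objStar Q) (M.Xbar (M.VStar Q)) ∧
      (∀ u : ℕ → ℕ → (Fin m → ℝ) × ((Fin n → ℝ) × ℝ) × ℝ,
        (∀ kl kf : ℕ, 1 ≤ kf → kf ≤ kl →
          u kl kf ∈ DRI.argminOn (M.objHat (M.ambiguitySet (epsL kl) w kl))
            (M.Xbar (M.VHat (M.ambiguitySet (epsF kf) w kf)))) →
        ∀ a, DRI.IsAccumulationPoint a u →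
          a ∈ DRI.argminOn (M.objStar Q) (M.Xbar (M.VStar Q))) ∧
      -- the distributionally robust problem over `(x, y)`
      (∀ kl kf : ℕ, 1 ≤ kf → kf ≤ kl →
        (DRI.argminOn (M.objDRI (M.ambiguitySet (epsL kl) w kl))
          (M.feasibleDRI (M.ambiguitySet (epsF kf) w kf))).Nonempty) ∧
      limsup (fun kf : ℕ => limsup (fun kl : ℕ =>
          DRI.minValue (M.objDRI (M.ambiguitySet (epsL kl) w kl))
            (M.feasibleDRI (M.ambiguitySet (epsF kf) w kf))) atTop) atTop =
        DRI.minValue (M.objSI Q) (M.feasibleSI Q) ∧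
      (∀ u : ℕ → ℕ → (Fin m → ℝ) × (Fin n → ℝ),
        (∀ kl kf : ℕ, 1 ≤ kf → kf ≤ kl →
          u kl kf ∈ DRI.argminOn (M.objDRI (M.ambiguitySet (epsL kl) w kl))
            (M.feasibleDRI (M.ambiguitySet (epsF kf) w kf))) →
        ∀ a, DRI.IsAccumulationPoint a u →
          a ∈ DRI.argminOn (M.objSI Q) (M.feasibleSI Q)) := by
  have hXf := M.finite_X
  have hYb : ∀ x ∈ M.X, Bornology.IsBounded (M.Y x) := fun x hx => (hY x hx).2
  have hYc : ∀ x ∈ M.X, IsCompact (M.Y x) := fun x hx => DRI.Model.isCompact_Y (hYb x hx)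
  have hT : M.tRange.Nonempty := DRI.Model.tRange_nonempty hX hY hS hSc
  have hTc : IsCompact M.tRange := isCompact_Icc
  have hβL : 1 ≤ 1 / (1 - M.alphaL) := by
    rw [le_div_iff₀ (by linarith [halphaL.2])]
    linarith [halphaL.1]
  have hβF : 1 ≤ 1 / (1 - M.alphaF) := by
    rw [le_div_iff₀ (by linarith [halphaF.2])]
    linarith [halphaF.1]
  obtain ⟨R, hRpos, hR⟩ := hSc.isBounded.exists_pos_norm_le
  have hF1 := DRI.Model.isRegularRisk_tailMean hp hSc DRI.isTail_min hβF hRpos.le hR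
  have hL1 := DRI.Model.isRegularRisk_tailMean hp hSc DRI.isTail_max hβL hRpos.le hR
  have hF2 := DRI.Model.isRegularRisk_sSup_tailMean hp hSc hβF hRpos.le hR
  have hL2 := DRI.Model.isRegularRisk_sInf_tailMean hp hSc hβL hRpos.le hR
  have hmem := fun {x} (hx : x ∈ M.X) {y} =>
    DRI.Model.mem_argmaxOn_rhoF_iff hYb hSc hT hβF hQ hx (y := y)
  -- The leader's integrand ignores `t_f`, so only `(y, t_l)` is kept.
  have hπ : UniformContinuous fun z : ((Fin n → ℝ) × ℝ) × ℝ => (z.1.1, z.2) :=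
    (uniformContinuous_fst.comp uniformContinuous_fst).prodMk uniformContinuous_snd
  have hrho : (fun y => DRI.rhoF M.alphaF y Q) = fun y => ((sSup ((fun t =>
      DRI.tailMean (fun x => min x 0) (1 / (1 - M.alphaF)) Q (y, t)) '' univ) : ℝ) : EReal) :=
    funext (DRI.Model.rhoF_eq hSc hβF hQ)
  have huniq' : ∀ x ∈ M.X, ∃! y, y ∈ DRI.argmaxOn (fun y => DRI.rhoF M.alphaF y Q) (M.Y x) := by
    intro x hx
    obtain ⟨e, he, heu⟩ := huniq x hx
    refine ⟨e.1, (hmem hx).2 ⟨e.2, he⟩, fun y hy => ?_⟩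
    obtain ⟨t, ht⟩ := (hmem hx).1 hy
    rw [← heu _ ht]
  refine ⟨?_, ?_, DRI.Model.minValue_objStar_eq hYb hSc hT hβF hβL hQ, ?_⟩
  · exact DRI.argminOn_coe_nonempty
      (DRI.isCompact_bilevelPairs (V := fun x => M.VStar Q x ×ˢ M.tRange) hXf fun x hx =>
        (DRI.isCompact_argmaxOn_coe ((hYc x hx).prod hTc) (hF1.lipschitzWith hQ).continuous).prod hTc)
      (DRI.bilevelPairs_nonempty hX fun x hx =>
        Set.Nonempty.prod (huniq x hx).exists hT)
      ((hL1.lipschitzWith hQ).continuous.comp (hπ.continuous.comp continuous_snd))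
  · rw [show M.objSI Q = _ from funext fun z => DRI.Model.rhoL_eq hSc hβL hQ z.2]
    refine DRI.argminOn_coe_nonempty (DRI.isCompact_bilevelPairs
      (V := fun x => DRI.argmaxOn (fun y => DRI.rhoF M.alphaF y Q) (M.Y x)) hXf fun x hx => ?_)
      (DRI.bilevelPairs_nonempty hX fun x hx => (huniq' x hx).exists)
      ((hL2.lipschitzWith hQ).continuous.comp continuous_snd)
    rw [hrho]
    exact DRI.isCompact_argmaxOn_coe (hYc x hx) (hF2.lipschitzWith hQ).continuous
  filter_upwards [DRI.Model.ae_forall_sample_mem Q hQ, hL.ae_eventually_mem, hF.ae_eventually_mem]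
    with w hw hwL hwF
  have h1 := DRI.Model.bilevel_stability hp hSc hF1 hL1 hQ hL.eps_nonneg hF.eps_nonneg
    hL.tendsto hF.tendsto hw hwL hwF hXf hX (K := M.Ybar) (fun x hx => (hYc x hx).prod hTc)
    (fun x hx => (hY x hx).1.prod hT) huniq (P := fun V => V ×ˢ M.tRange)
    (fun _ _ h => prod_mono_left h) (fun _ h => h.prod hTc) (fun _ _ h => h.prod_const hTc hT) hπ
    (Fs := M.Xbar (M.VStar Q)) (F := fun k => M.Xbar (M.VHat (M.ambiguitySet (epsF k) w k)))
    (Ψs := M.objStar Q) (Ψ := fun k => M.objHat (M.ambiguitySet (epsL k) w k))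
    rfl (fun _ => rfl) (fun _ => rfl) (fun _ _ => rfl)
  have h2 := DRI.Model.bilevel_stability hp hSc hF2 hL2 hQ hL.eps_nonneg hF.eps_nonneg
    hL.tendsto hF.tendsto hw hwL hwF hXf hX (K := M.Y) hYc
    (fun x hx => (hY x hx).1) (by simpa only [hrho] using huniq') (P := id)
    monotone_id (fun _ h => h) (fun _ _ h => h) uniformContinuous_id
    (Fs := M.feasibleSI Q) (F := fun k => M.feasibleDRI (M.ambiguitySet (epsF k) w k))
    (Ψs := M.objSI Q) (Ψ := fun k => M.objDRI (M.ambiguitySet (epsL k) w k))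
    (by rw [← hrho]; rfl)
    -- The real form of the risk is available only for laws on `S`; membership in the ball supplies
    -- this.
    (fun k => by
      rw [show (fun y => ⨅ Q ∈ M.ambiguitySet (epsF k) w k, _) = _ from funext fun y =>
        (iInf_congr fun Q' => iInf_congr fun hQ' => DRI.Model.rhoF_eq hSc hβF hQ'.1 y).symm]
      rfl)
    (fun z => DRI.Model.rhoL_eq hSc hβL hQ z.2)
    (fun k z => iSup_congr fun Q' => iSup_congr fun hQ' => DRI.Model.rhoL_eq hSc hβL hQ'.1 z.2)
  exact ⟨h1.1, h1.2.1, h1.2.2, h2.1, h2.2.1, h2.2.2⟩
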